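/- Let $n\ge 1$. A cube means a cube in $\mathbb R^n$ with sides parallel to the coordinate axes; $|Q|$ is its Lebesgue measure and $f_Q=\frac1{|Q|}\int_Q f\,dx$. A weight is a nonnegative locally integrable function on $\mathbb R^n$ with values in $(0,\infty)$ almost everywhere; for a weight $\mu$ put $\mu(Q)=\int_Q\mu(x)\,dx$. We write $\mu\in A_1$ if there is $C>0$ such that for every cube $Q$, $\frac1{|Q|}\int_Q\mu(y)\,dy\le C\mu(x)$ for a.e. $x\in Q$. For $0<\beta<1$ and $\mu\in A_1$, the weighted Lipschitz space $Lip_{\beta,\mu}$ consists of the locally integrable functions $f$ on $\mathbb R^n$ with $$\sup_Q\frac1{\mu(Q)^{\beta/n}}\,\frac1{\mu(Q)}\int_Q|f(x)-f_Q|\,dx<\infty .$$ For $1\le p<\infty$, $0<\kappa<1$ and weights $u,v$, the weighted Morrey space $L^{p,\kappa}(u,v)$ consists of the $f\in L^p_{\rm loc}(u)$ with $$\|f\|_{L^{p,\kappa}(u,v)}=\sup_Q\Big(\frac1{v(Q)^{\kappa}}\int_Q|f(x)|^p u(x)\,dx\Big)^{1/p}<\infty ,$$ and $L^{p,\kappa}(\mu)=L^{p,\kappa}(\mu,\mu)$.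 All suprema are over all cubes $Q$. For a locally integrable $b$, the maximal commutator is $$M_b(f)(x)=\sup_{Q\ni x}\frac1{|Q|}\int_Q|b(x)-b(y)||f(y)|\,dy .$$ **Theorem.** Let $b$ be a (real-valued) locally integrable function on $\mathbb R^n$, $\mu\in A_1$, $0<\beta<1$, $1<p<n/\beta$, $1/q=1/p-\beta/n$ and $0<\kappa<p/q$. Then the following assertions are equivalent: (1) $b\in Lip_{\beta,\mu}$. (2) $M_b$ is bounded from $L^{p,\kappa}(\mu)$ to $L^{q,\kappa q/p}(\mu^{1-q},\mu)$; that is, there is a constant $C$ such that for every $f\in L^{p,\kappa}(\mu)$ one has $M_b(f)\in L^{q,\kappa q/p}(\mu^{1-q},\mu)$ and $\|M_b(f)\|_{L^{q,\kappa q/p}(\mu^{1-q},\mu)}\le C\|f\|_{L^{p,\kappa}(\mu)}$. -/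

import Mathlib

open MeasureTheory Set
open scoped ENNReal NNReal

namespace WeightedMorrey

/-- `Q` is a (closed, nondegenerate) cube in `ℝⁿ` with sides parallel to the coordinate axes:
lower corner `a`, side length `l > 0`. -/
def IsCube {n : ℕ} (Q : Set (Fin n → ℝ)) : Prop :=
  ∃ (a : Fin n → ℝ) (l : ℝ), 0 < l ∧ Q = Set.Icc a (fun i => a i + l)

/-- A weight: a nonnegative locally integrable function on `ℝⁿ`, positive (and, being
real-valued, finite) almost everywhere. -/
structure IsWeight {n : ℕ} (w : (Fin n → ℝ) → ℝ) : Prop where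
  nonneg : ∀ x, 0 ≤ w x
  locallyIntegrable : LocallyIntegrable w volume
  ae_pos : ∀ᵐ x, 0 < w x

/-- The Muckenhoupt class `A₁`: there is `C > 0` such that, for every cube `Q`, the average of `w`
over `Q` is at most `C * w x` for almost every `x ∈ Q`. -/
def MemA1 {n : ℕ} (w : (Fin n → ℝ) → ℝ) : Prop :=
  IsWeight w ∧ ∃ C : ℝ, 0 < C ∧ ∀ Q : Set (Fin n → ℝ), IsCube Q →
    ∀ᵐ x ∂(volume.restrict Q), (⨍ y in Q, w y) ≤ C * w x

/-- `w(Q) = ∫_Q w(x) dx`, as an element of `[0,∞]`. -/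
noncomputable def wmeas {n : ℕ} (w : (Fin n → ℝ) → ℝ) (Q : Set (Fin n → ℝ)) : ℝ≥0∞ :=
  ∫⁻ x in Q, ENNReal.ofReal (w x)

/-- The weighted Lipschitz seminorm with exponent `1 ≤ p < ∞`, with values in `[0,∞]`:
`sup_Q w(Q)^(-β/n) * (w(Q)⁻¹ * ∫_Q |f - f_Q|^p w^(1-p))^(1/p)`. -/
noncomputable def lipSeminorm {n : ℕ} (p β : ℝ) (w f : (Fin n → ℝ) → ℝ) : ℝ≥0∞ :=
  ⨆ (Q : Set (Fin n → ℝ)) (_ : IsCube Q),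
    (wmeas w Q ^ (β / (n : ℝ)))⁻¹ *
      ((wmeas w Q)⁻¹ *
        ∫⁻ x in Q, ‖f x - ⨍ y in Q, f y‖ₑ ^ p * ENNReal.ofReal (w x ^ (1 - p))) ^ (1 / p)

/-- The weighted Lipschitz space of exponent `p`, `1 ≤ p < ∞`. -/
def MemLipP {n : ℕ} (p β : ℝ) (w f : (Fin n → ℝ) → ℝ) : Prop :=
  LocallyIntegrable f volume ∧ lipSeminorm p β w f < ∞

/-- The weighted Lipschitz space `Lip_{β,w}`, that is, the one with exponent `p = 1`. -/
def MemLip {n : ℕ} (β : ℝ) (w f : (Fin n → ℝ) → ℝ) : Prop :=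
  MemLipP 1 β w f

/-- The norm of the two-weight Morrey space `L^{p,κ}(u,v)`, with values in `[0,∞]`:
`sup_Q (v(Q)^(-κ) * ∫_Q |f|^p u)^(1/p)`. It is defined for real-valued and for `[0,∞]`-valued
functions alike. -/
noncomputable def morreyNorm {n : ℕ} {E : Type*} [ENorm E] (p κ : ℝ) (u v : (Fin n → ℝ) → ℝ)
    (f : (Fin n → ℝ) → E) : ℝ≥0∞ :=
  ⨆ (Q : Set (Fin n → ℝ)) (_ : IsCube Q),
    ((wmeas v Q ^ κ)⁻¹ * ∫⁻ x in Q, ‖f x‖ₑ ^ p * ENNReal.ofReal (u x)) ^ (1 / p)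

/-- Membership in `L^{p,κ}(u,v)`: `f` is (a.e. strongly) measurable, locally in `L^p(u)`, and has
finite Morrey norm. -/
def MemMorrey {n : ℕ} {E : Type*} [TopologicalSpace E] [ENorm E] (p κ : ℝ)
    (u v : (Fin n → ℝ) → ℝ) (f : (Fin n → ℝ) → E) : Prop :=
  AEStronglyMeasurable f volume ∧
  (∀ K : Set (Fin n → ℝ), IsCompact K →
    ∫⁻ x in K, ‖f x‖ₑ ^ p * ENNReal.ofReal (u x) < ∞) ∧
  morreyNorm p κ u v f < ∞

/-- The maximal commutator
`M_b f x = sup_{Q ∋ x} |Q|⁻¹ * ∫_Q |b x - b y| |f y| dy`, with values in `[0,∞]`. -/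
noncomputable def maximalCommutator {n : ℕ} (b f : (Fin n → ℝ) → ℝ) (x : Fin n → ℝ) : ℝ≥0∞ :=
  ⨆ (Q : Set (Fin n → ℝ)) (_ : IsCube Q) (_ : x ∈ Q),
    (volume Q)⁻¹ * ∫⁻ y in Q, ‖b x - b y‖ₑ * ‖f y‖ₑ

/-- The operator `T` (with values in `[0,∞]`-valued functions) is bounded from `L^{p,κ}(u₁,v₁)` to
`L^{q,ν}(u₂,v₂)`: it maps the first space into the second, with
`‖T f‖ ≤ C ‖f‖` for a constant `C` independent of `f`. -/
def IsMorreyBounded {n : ℕ} (T : ((Fin n → ℝ) → ℝ) → (Fin n → ℝ) → ℝ≥0∞)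
    (p κ : ℝ) (u₁ v₁ : (Fin n → ℝ) → ℝ) (q ν : ℝ) (u₂ v₂ : (Fin n → ℝ) → ℝ) : Prop :=
  ∃ C : ℝ≥0, ∀ f : (Fin n → ℝ) → ℝ, MemMorrey p κ u₁ v₁ f →
    MemMorrey q ν u₂ v₂ (T f) ∧
      morreyNorm q ν u₂ v₂ (T f) ≤ (C : ℝ≥0∞) * morreyNorm p κ u₁ v₁ f

end WeightedMorrey

/-!
# Weighted Lipschitz functions and the maximal commutator on weighted Morrey spaces

Cubes are closed balls of the sup norm on `Fin n → ℝ`, and everything is measured with `w dx`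
(`wMeasure w`). Two consequences of the `A₁` condition `w(B) / |B| ≤ C w(x)` carry the argument:
the measure `w dx` is doubling (`wMeasure_le_of_subset`), and halving a cube decreases its measure
by a fixed factor `θ < 1` (`exists_wMeasure_half_le`).

If `b` is in the weighted Lipschitz space, reverse doubling lets one telescope the means of `b`
along cubes that shrink to `x`, which gives `|b x - b_B| ≤ K w(x) w(B)^(β/n)` for almost every
`x` and all cubes `B ∋ x` (`exists_ae_enorm_sub_average_le`). Hence `M_b f` is at most a multiple of
`w` times the fractional maximal function of order `β/n` with respect to `w dx`
(`ae_maximalCommutator_le`). As `w ^ q * w ^ (1 - q) = w`, it remains to bound this fractional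
maximal function from `L^{p,κ}(w)` to `L^{q,κq/p}(w)`. On a fixed cube, the means over larger cubes
are controlled by the Morrey condition, as the resulting exponent `κ/p - 1/q` of `w(B)` is negative;
the means over smaller cubes are controlled by Hedberg's inequality (`rpow_mul_inv_mul_le`) and the
`L^p` maximal inequality for a doubling measure (`lintegral_ballMaximal_rpow_le`), which follows
from Vitali's covering lemma. The two parts meet in `exists_setLIntegral_fracMaximal_le`.

Conversely, for `f` the indicator function of a cube `B`, `M_b f ≥ |b - b_B|` on `B`, and Hölder's
inequality turns the Morrey bound for `M_b f` into the Lipschitz condition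
(`memLip_of_isMorreyBounded`).

Uncountable suprema over cubes are reduced to a countable family of cubes, `gridCenter` and
`gridRadius`, which approximates every cube from outside; this gives measurability and null sets
that do not depend on the cube.
-/

namespace WeightedMorrey

open Metric Filter Topology

/-! ### The maximal inequality for a countable family of balls -/

section Maximal

variable {X ι : Type*} [PseudoMetricSpace X] [MeasurableSpace X] [OpensMeasurableSpace X]

/-- The maximal function of `g` with respect to `ν` and the family of closed balls
`closedBall (c i) (r i)`: at `x`, the supremum of the `ν`-averages of `g` over the balls of the
family that contain `x`. -/
noncomputable def ballMaximal (ν : Measure X) (c : ι → X) (r : ι → ℝ) (g : X → ℝ≥0∞) (x : X) :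
    ℝ≥0∞ :=
  ⨆ i, (closedBall (c i) (r i)).indicator
    (fun _ => (ν (closedBall (c i) (r i)))⁻¹ * ∫⁻ y in closedBall (c i) (r i), g y ∂ν) x

lemma measurable_ballMaximal [Countable ι] (ν : Measure X) (c : ι → X) (r : ι → ℝ)
    (g : X → ℝ≥0∞) : Measurable (ballMaximal ν c r g) :=
  Measurable.iSup fun _ => measurable_const.indicator isClosed_closedBall.measurableSet

/-- The weak type `(1, 1)` inequality. Finitely many of the balls on which the mean exceeds `t` have
a disjoint subfamily whose fivefold enlargements cover them; the bound does not depend on the finite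
family. -/
lemma mul_measure_lt_ballMaximal_le [Countable ι] (ν : Measure X) (c : ι → X) (r : ι → ℝ)
    (g : X → ℝ≥0∞) (D : ℝ≥0∞)
    (hD : ∀ i, ν (closedBall (c i) (5 * r i)) ≤ D * ν (closedBall (c i) (r i))) (t : ℝ≥0∞) :
    t * ν {x | t < ballMaximal ν c r g x} ≤ D * ∫⁻ y, g y ∂ν := by
  set I : Set ι := {i | t < (ν (closedBall (c i) (r i)))⁻¹ *
    ∫⁻ y in closedBall (c i) (r i), g y ∂ν}
  have hset : {x | t < ballMaximal ν c r g x} ⊆ ⋃ i : I, closedBall (c i) (r i) := by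
    intro x hx
    obtain ⟨i, hi⟩ := lt_iSup_iff.1 (show t < ballMaximal ν c r g x from hx)
    by_cases hxi : x ∈ closedBall (c i) (r i)
    · rw [indicator_of_mem hxi] at hi
      exact mem_iUnion.2 ⟨⟨i, hi⟩, hxi⟩
    · rw [indicator_of_notMem hxi] at hi
      exact absurd hi not_lt_zero
  have hfin : ∀ s : Finset I, t * ν (⋃ i ∈ s, closedBall (c i) (r i)) ≤ D * ∫⁻ y, g y ∂ν := by
    intro s
    obtain ⟨R, hR⟩ : BddAbove ((fun i : I => r i) '' s) := (s.finite_toSet.image _).bddAbove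
    obtain ⟨u, hus, hdisj, hcov⟩ :=
      Vitali.exists_disjoint_subfamily_covering_enlargement_closedBall (s : Set I)
        (fun i => c i) (fun i => r i) R (fun i hi => hR (mem_image_of_mem _ hi)) 5 (by norm_num)
    have hufin : u.Finite := s.finite_toSet.subset hus
    lift u to Finset I using hufin
    calc t * ν (⋃ i ∈ s, closedBall (c i) (r i))
        ≤ t * ν (⋃ i ∈ u, closedBall (c i) (5 * r i)) := by
          gcongr t * ν ?_
          refine iUnion₂_subset fun i hi => ?_
          obtain ⟨j, hj, hij⟩ := hcov i hi
          exact hij.trans (subset_biUnion_of_mem (u := fun i : I => closedBall (c i) (5 * r i)) hj)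
      _ ≤ t * ∑ i ∈ u, D * ν (closedBall (c i) (r i)) := by
          gcongr
          exact (measure_biUnion_finset_le _ _).trans (Finset.sum_le_sum fun i _ => hD i)
      _ = D * ∑ i ∈ u, t * ν (closedBall (c i) (r i)) := by
          simp_rw [Finset.mul_sum]
          exact Finset.sum_congr rfl fun _ _ => by ring
      _ ≤ D * ∑ i ∈ u, ∫⁻ y in closedBall (c i) (r i), g y ∂ν := by
          gcongr with i _
          have hi : t < _ := i.2
          calc t * ν (closedBall (c i) (r i))
              ≤ ((ν (closedBall (c i) (r i)))⁻¹ * ∫⁻ y in closedBall (c i) (r i), g y ∂ν) *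
                  ν (closedBall (c i) (r i)) := by gcongr
            _ = ((ν (closedBall (c i) (r i)))⁻¹ * ν (closedBall (c i) (r i))) *
                  ∫⁻ y in closedBall (c i) (r i), g y ∂ν := by ring
            _ ≤ 1 * ∫⁻ y in closedBall (c i) (r i), g y ∂ν := by
                gcongr
                exact ENNReal.inv_mul_le_one _
            _ = _ := one_mul _
      _ = D * ∫⁻ y in ⋃ i ∈ u, closedBall (c i) (r i), g y ∂ν := by
          rw [lintegral_biUnion_finset hdisj fun i _ => isClosed_closedBall.measurableSet]
      _ ≤ D * ∫⁻ y, g y ∂ν := by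
          gcongr
          exact Measure.restrict_le_self
  calc t * ν {x | t < ballMaximal ν c r g x}
      ≤ t * ν (⋃ i : I, closedBall (c i) (r i)) := by gcongr
    _ = ⨆ s : Finset I, t * ν (⋃ i ∈ s, closedBall (c i) (r i)) := by
        rw [← ENNReal.mul_iSup, iUnion_eq_iUnion_finset, Directed.measure_iUnion]
        exact directed_of_isDirected_le fun s₁ s₂ h => biUnion_subset_biUnion_left h
    _ ≤ _ := iSup_le hfin

/-- The weak type inequality applied to the part of `g` above height `t / 2`: the remaining part
contributes at most `t / 2` to the maximal function. -/
lemma mul_measure_lt_ballMaximal_le_setLIntegral [Countable ι] (ν : Measure X) (c : ι → X)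
    (r : ι → ℝ) {g : X → ℝ≥0∞} (hg : Measurable g) (D : ℝ≥0∞)
    (hD : ∀ i, ν (closedBall (c i) (5 * r i)) ≤ D * ν (closedBall (c i) (r i))) (t : ℝ≥0∞) :
    t * ν {x | t < ballMaximal ν c r g x} ≤ 2 * D * ∫⁻ y in {y | t < 2 * g y}, g y ∂ν := by
  have hS : MeasurableSet {y | t < 2 * g y} := measurableSet_lt measurable_const (hg.const_mul 2)
  set g' := {y | t < 2 * g y}.indicator g
  have hle : ∀ y, g y ≤ g' y + t / 2 := by
    intro y
    by_cases hy : t < 2 * g y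
    · exact (indicator_of_mem (s := {y | t < 2 * g y}) hy g).ge.trans le_self_add
    · refine le_add_left ?_
      rw [ENNReal.le_div_iff_mul_le (by simp) (by simp), mul_comm]
      exact not_lt.1 hy
  have hM : ∀ x, ballMaximal ν c r g x ≤ ballMaximal ν c r g' x + t / 2 := by
    intro x
    refine iSup_le fun i => ?_
    by_cases hx : x ∈ closedBall (c i) (r i)
    · refine le_trans ?_ (add_le_add_left (le_iSup _ i) _)
      rw [indicator_of_mem hx, indicator_of_mem hx]
      calc _ ≤ (ν (closedBall (c i) (r i)))⁻¹ *
              ∫⁻ y in closedBall (c i) (r i), (g' y + t / 2) ∂ν := by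
            gcongr with y
            exact hle y
        _ = (ν (closedBall (c i) (r i)))⁻¹ * ∫⁻ y in closedBall (c i) (r i), g' y ∂ν +
              ((ν (closedBall (c i) (r i)))⁻¹ * ν (closedBall (c i) (r i))) * (t / 2) := by
            rw [lintegral_add_right _ measurable_const, lintegral_const, Measure.restrict_apply_univ]
            ring
        _ ≤ _ := by
            gcongr
            exact mul_le_of_le_one_left' (ENNReal.inv_mul_le_one _)
    · rw [indicator_of_notMem hx]
      exact zero_le
  have hsub : {x | t < ballMaximal ν c r g x} ⊆ {x | t / 2 < ballMaximal ν c r g' x} := by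
    intro x hx
    have h1 : t < ballMaximal ν c r g' x + t / 2 := lt_of_lt_of_le hx (hM x)
    by_contra h
    have h2 : ballMaximal ν c r g' x ≤ t / 2 := not_lt.1 h
    have : ballMaximal ν c r g' x + t / 2 ≤ t := (add_le_add_left h2 _).trans (ENNReal.add_halves t).le
    exact absurd h1 (not_lt.2 this)
  calc t * ν {x | t < ballMaximal ν c r g x}
      ≤ t * ν {x | t / 2 < ballMaximal ν c r g' x} := by gcongr
    _ = 2 * (t / 2 * ν {x | t / 2 < ballMaximal ν c r g' x}) := by
        rw [← mul_assoc, ENNReal.mul_div_cancel (by simp) (by simp)]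
    _ ≤ 2 * (D * ∫⁻ y, g' y ∂ν) := by
        gcongr 2 * ?_
        exact mul_measure_lt_ballMaximal_le ν c r g' D hD _
    _ = _ := by rw [lintegral_indicator hS, mul_assoc]

/-- The strong type `(p, p)` inequality. The layer cake formula is used twice: for the maximal
function, truncated at height `N` to be finite, with exponent `p`, and, after the weak type
inequality, for `2 * g` with exponent `p - 1` and the measure `g dν`. -/
lemma lintegral_ballMaximal_rpow_le [Countable ι] (ν : Measure X) (c : ι → X)
    (r : ι → ℝ) {g : X → ℝ≥0} (hg : Measurable g) {p : ℝ} (hp : 1 < p) (D : ℝ≥0∞)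
    (hD : ∀ i, ν (closedBall (c i) (5 * r i)) ≤ D * ν (closedBall (c i) (r i))) :
    ∫⁻ x, ballMaximal ν c r (fun y => g y) x ^ p ∂ν ≤
      ENNReal.ofReal p * (ENNReal.ofReal (p - 1))⁻¹ * 2 ^ p * D * ∫⁻ y, (g y : ℝ≥0∞) ^ p ∂ν := by
  have hp0 : 0 < p := by linarith
  have hp1 : 0 < p - 1 := by linarith
  set F := ballMaximal ν c r (fun y => (g y : ℝ≥0∞))
  have hF : Measurable F := measurable_ballMaximal ν c r _
  have hg' : Measurable fun y => (g y : ℝ≥0∞) := hg.coe_nnreal_ennreal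
  set νg := ν.withDensity (fun y => (g y : ℝ≥0∞))
  have key : ∀ N : ℕ, ∫⁻ x, (min (F x) N) ^ p ∂ν ≤
      ENNReal.ofReal p * (ENNReal.ofReal (p - 1))⁻¹ * 2 ^ p * D * ∫⁻ y, (g y : ℝ≥0∞) ^ p ∂ν := by
    intro N
    have hfin : ∀ x, min (F x) N ≠ ∞ := fun x => ne_top_of_le_ne_top (by simp) (min_le_right _ _)
    calc ∫⁻ x, (min (F x) N) ^ p ∂ν
        = ∫⁻ x, ENNReal.ofReal ((min (F x) N).toReal ^ p) ∂ν := by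
          refine lintegral_congr fun x => ?_
          rw [ENNReal.toReal_rpow, ENNReal.ofReal_toReal]
          exact ENNReal.rpow_ne_top_of_nonneg hp0.le (hfin x)
      _ = ENNReal.ofReal p * ∫⁻ t in Ioi 0, ν {x | t < (min (F x) N).toReal} *
            ENNReal.ofReal (t ^ (p - 1)) :=
          lintegral_rpow_eq_lintegral_meas_lt_mul ν (ae_of_all _ fun _ => ENNReal.toReal_nonneg)
            (hF.min measurable_const).ennreal_toReal.aemeasurable hp0
      _ ≤ ENNReal.ofReal p * ∫⁻ t in Ioi (0 : ℝ), (2 * D) * (νg {y | t < 2 * (g y : ℝ)} *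
            ENNReal.ofReal (t ^ (p - 1 - 1))) := by
          gcongr ENNReal.ofReal p * ?_
          refine setLIntegral_mono_ae' measurableSet_Ioi (ae_of_all _ fun t ht => ?_)
          have ht : 0 < t := ht
          have e : ENNReal.ofReal (t ^ (p - 1)) =
              ENNReal.ofReal t * ENNReal.ofReal (t ^ (p - 1 - 1)) := by
            rw [← ENNReal.ofReal_mul ht.le]
            congr 1
            nth_rewrite 2 [← Real.rpow_one t]
            rw [← Real.rpow_add ht]
            congr 1
            ring
          have hset : {y | ENNReal.ofReal t < 2 * (g y : ℝ≥0∞)} = {y | t < 2 * (g y : ℝ)} := by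
            ext y
            simp only [mem_ofPred_eq]
            rw [ENNReal.ofReal_lt_iff_lt_toReal ht.le (by finiteness)]
            simp
          calc _ ≤ ν {x | ENNReal.ofReal t < F x} * ENNReal.ofReal (t ^ (p - 1)) := by
                gcongr with x
                intro hx
                refine lt_of_lt_of_le ?_ (min_le_left (F x) N)
                rwa [ENNReal.ofReal_lt_iff_lt_toReal ht.le (hfin x)]
            _ = (ENNReal.ofReal t * ν {x | ENNReal.ofReal t < F x}) *
                  ENNReal.ofReal (t ^ (p - 1 - 1)) := by rw [e]; ring
            _ ≤ (2 * D * ∫⁻ y in {y | ENNReal.ofReal t < 2 * (g y : ℝ≥0∞)}, g y ∂ν) *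
                  ENNReal.ofReal (t ^ (p - 1 - 1)) := by
                gcongr ?_ * _
                exact mul_measure_lt_ballMaximal_le_setLIntegral ν c r hg' D hD _
            _ = _ := by
                rw [hset, withDensity_apply _ (measurableSet_lt measurable_const (by fun_prop))]
                ring
      _ = ENNReal.ofReal p * (2 * D) * ∫⁻ t in Ioi (0 : ℝ), νg {y | t < 2 * (g y : ℝ)} *
            ENNReal.ofReal (t ^ (p - 1 - 1)) := by
          rw [lintegral_const_mul]
          · ring
          refine Measurable.mul (f := fun t : ℝ => νg {y | t < 2 * (g y : ℝ)}) ?_ (by fun_prop)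
          exact Antitone.measurable fun s t hst => measure_mono fun y hy => lt_of_le_of_lt hst hy
      _ = ENNReal.ofReal p * (2 * D) * ((ENNReal.ofReal (p - 1))⁻¹ *
            ∫⁻ y, ENNReal.ofReal ((2 * (g y : ℝ)) ^ (p - 1)) ∂νg) := by
          rw [lintegral_rpow_eq_lintegral_meas_lt_mul νg (ae_of_all _ fun y => by positivity)
            (by fun_prop) hp1, ← mul_assoc (ENNReal.ofReal (p - 1))⁻¹, ENNReal.inv_mul_cancel
            (by simpa using hp) (by simp), one_mul]
      _ = ENNReal.ofReal p * (2 * D) * ((ENNReal.ofReal (p - 1))⁻¹ *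
            ∫⁻ y, 2 ^ (p - 1) * (g y : ℝ≥0∞) ^ p ∂ν) := by
          rw [lintegral_withDensity_eq_lintegral_mul _ hg' (by fun_prop)]
          congr 2
          refine lintegral_congr fun y => ?_
          simp only [Pi.mul_apply]
          rw [← ENNReal.ofReal_rpow_of_nonneg (by positivity) hp1.le,
            ENNReal.ofReal_mul (by norm_num), ENNReal.mul_rpow_of_nonneg _ _ hp1.le]
          rw [ENNReal.ofReal_coe_nnreal, ENNReal.ofReal_ofNat, mul_left_comm]
          congr 1
          nth_rewrite 1 [← ENNReal.rpow_one (g y : ℝ≥0∞)]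
          rw [← ENNReal.rpow_add_of_nonneg _ _ zero_le_one hp1.le]
          congr 1
          ring
      _ = _ := by
          rw [lintegral_const_mul _ (by fun_prop)]
          have : (2 : ℝ≥0∞) ^ p = 2 * 2 ^ (p - 1) := by
            nth_rewrite 2 [← ENNReal.rpow_one 2]
            rw [← ENNReal.rpow_add_of_nonneg _ _ zero_le_one hp1.le]
            congr 1
            ring
          rw [this]
          ring
  calc ∫⁻ x, F x ^ p ∂ν = ∫⁻ x, ⨆ N : ℕ, (min (F x) N) ^ p ∂ν := by
        refine lintegral_congr fun x => ?_
        have : F x = ⨆ N : ℕ, min (F x) N := by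
          rw [← inf_iSup_eq, ENNReal.iSup_natCast, inf_top_eq]
        conv_lhs => rw [this]
        exact (ENNReal.orderIsoRpow p hp0).map_iSup _
    _ = ⨆ N : ℕ, ∫⁻ x, (min (F x) N) ^ p ∂ν := by
        refine lintegral_iSup (fun N => (hF.min measurable_const).pow_const p) ?_
        intro N M h x
        exact ENNReal.rpow_le_rpow (min_le_min_left _ (by exact_mod_cast h)) hp0.le
    _ ≤ _ := iSup_le key

end Maximal

/-! ### Cubes and approximation by countably many cubes -/

section Cubes

variable {n : ℕ}

lemma isCube_iff {Q : Set (Fin n → ℝ)} :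
    IsCube Q ↔ ∃ (c : Fin n → ℝ) (r : ℝ), 0 < r ∧ Q = closedBall c r := by
  have key : ∀ (a : Fin n → ℝ) (l : ℝ), 0 < l →
      Icc a (fun i => a i + l) = closedBall (fun i => a i + l / 2) (l / 2) := by
    intro a l hl
    rw [closedBall_pi _ (by positivity), ← pi_univ_Icc]
    congr 1
    ext i : 1
    rw [Real.closedBall_eq_Icc]
    congr 1 <;> ring
  constructor
  · rintro ⟨a, l, hl, rfl⟩
    exact ⟨_, l / 2, by positivity, key a l hl⟩
  · rintro ⟨c, r, hr, rfl⟩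
    refine ⟨fun i => c i - r, 2 * r, by positivity, ?_⟩
    rw [key _ _ (by positivity)]
    congr 1
    · ext i; ring
    · ring

lemma isCube_closedBall (c : Fin n → ℝ) {r : ℝ} (hr : 0 < r) : IsCube (closedBall c r) :=
  isCube_iff.2 ⟨c, r, hr, rfl⟩

lemma volume_cube (c : Fin n → ℝ) {r : ℝ} (hr : 0 < r) :
    volume (closedBall c r) = ENNReal.ofReal ((2 * r) ^ n) := by
  rw [Real.volume_pi_closedBall c hr.le, Fintype.card_fin]

lemma volume_cube_ne_zero (c : Fin n → ℝ) {r : ℝ} (hr : 0 < r) : volume (closedBall c r) ≠ 0 := by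
  rw [volume_cube c hr]
  have : 0 < (2 * r) ^ n := by positivity
  simpa using this

lemma volume_cube_ne_top (c : Fin n → ℝ) {r : ℝ} (hr : 0 < r) : volume (closedBall c r) ≠ ∞ := by
  rw [volume_cube c hr]
  exact ENNReal.ofReal_ne_top

lemma volume_cube_mul (c c' : Fin n → ℝ) {r s : ℝ} (hr : 0 < r) (hs : 0 < s) :
    volume (closedBall c (s * r)) = ENNReal.ofReal s ^ n * volume (closedBall c' r) := by
  rw [volume_cube c (by positivity), volume_cube c' hr, ← ENNReal.ofReal_pow hs.le,
    ← ENNReal.ofReal_mul (by positivity)]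
  congr 1
  rw [← mul_pow]
  ring

/-- The centres of a countable family of cubes that approximates every cube from outside. -/
noncomputable def gridCenter (n : ℕ) (i : ℕ × {q : ℚ // 0 < q}) : Fin n → ℝ :=
  TopologicalSpace.denseSeq (Fin n → ℝ) i.1

/-- The half side lengths of the cubes centred at `gridCenter`. -/
def gridRadius (i : ℕ × {q : ℚ // 0 < q}) : ℝ := (i.2 : ℚ)

lemma gridRadius_pos (i : ℕ × {q : ℚ // 0 < q}) : 0 < gridRadius i := by
  exact Rat.cast_pos.2 i.2.2

lemma exists_grid_cube (c : Fin n → ℝ) {r ε : ℝ} (hr : 0 < r) (hε : 0 < ε) :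
    ∃ i, closedBall c r ⊆ closedBall (gridCenter n i) (gridRadius i) ∧ gridRadius i < r + ε := by
  obtain ⟨k, hk⟩ := (TopologicalSpace.denseRange_denseSeq (Fin n → ℝ)).exists_dist_lt c (half_pos hε)
  obtain ⟨q, hq1, hq2⟩ := exists_rat_btwn (show r + ε / 2 < r + ε by linarith)
  have hq : 0 < q := by
    have : (0 : ℝ) < q := by linarith
    exact_mod_cast this
  refine ⟨(k, ⟨q, hq⟩), closedBall_subset_closedBall' ?_, hq2⟩
  change r + dist c (TopologicalSpace.denseSeq (Fin n → ℝ) k) ≤ (q : ℝ)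
  linarith

/-- If a monotone set function `A`, divided by Lebesgue measure, is bounded by `S` on the
grid cubes that contain `x`, then it is so on all cubes that contain `x`. -/
lemma inv_volume_mul_le_of_grid {A : Set (Fin n → ℝ) → ℝ≥0∞} (hA : Monotone A) {x : Fin n → ℝ}
    {S : ℝ≥0∞}
    (h : ∀ i, x ∈ closedBall (gridCenter n i) (gridRadius i) →
      (volume (closedBall (gridCenter n i) (gridRadius i)))⁻¹ *
        A (closedBall (gridCenter n i) (gridRadius i)) ≤ S)
    {c : Fin n → ℝ} {r : ℝ} (hr : 0 < r) (hx : x ∈ closedBall c r) :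
    (volume (closedBall c r))⁻¹ * A (closedBall c r) ≤ S := by
  have hlim : Tendsto (fun ε : ℝ => (ENNReal.ofReal ((2 * (r + ε)) ^ n))⁻¹ * A (closedBall c r))
      (𝓝[>] 0) (𝓝 ((ENNReal.ofReal ((2 * r) ^ n))⁻¹ * A (closedBall c r))) := by
    refine ENNReal.Tendsto.mul_const ?_ (Or.inl (by simp))
    refine tendsto_inv_iff.2 (ENNReal.tendsto_ofReal ?_)
    have : ContinuousAt (fun ε : ℝ => (2 * (r + ε)) ^ n) 0 := by fun_prop
    simpa using this.tendsto.mono_left nhdsWithin_le_nhds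
  rw [volume_cube c hr]
  refine le_of_tendsto hlim ?_
  filter_upwards [self_mem_nhdsWithin] with ε hε
  have hε : 0 < ε := hε
  obtain ⟨i, hi, hir⟩ := exists_grid_cube c hr hε
  refine le_trans ?_ (h i (hi hx))
  rw [volume_cube _ (gridRadius_pos i)]
  have := gridRadius_pos i
  gcongr
  exact hA hi

end Cubes

/-! ### Doubling and reverse doubling of `A₁` weights -/

section Weights

variable {n : ℕ} {w : (Fin n → ℝ) → ℝ}

/-- The measure `w dx`. -/
noncomputable def wMeasure (w : (Fin n → ℝ) → ℝ) : Measure (Fin n → ℝ) :=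
  volume.withDensity fun x => ENNReal.ofReal (w x)

lemma wmeas_eq (w : (Fin n → ℝ) → ℝ) (Q : Set (Fin n → ℝ)) : wmeas w Q = wMeasure w Q :=
  (withDensity_apply' _ Q).symm

lemma wMeasure_absolutelyContinuous (w : (Fin n → ℝ) → ℝ) : wMeasure w ≪ volume :=
  withDensity_absolutelyContinuous _ _

namespace IsWeight

lemma aemeasurable (hw : IsWeight w) : AEMeasurable w :=
  hw.locallyIntegrable.aestronglyMeasurable.aemeasurable

lemma integrableOn_cube (hw : IsWeight w) (c : Fin n → ℝ) (r : ℝ) :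
    IntegrableOn w (closedBall c r) :=
  hw.locallyIntegrable.integrableOn_isCompact (isCompact_closedBall c r)

lemma wMeasure_cube_eq (hw : IsWeight w) (c : Fin n → ℝ) (r : ℝ) :
    wMeasure w (closedBall c r) = ENNReal.ofReal (∫ x in closedBall c r, w x) := by
  rw [← wmeas_eq, wmeas, ofReal_integral_eq_lintegral_ofReal (hw.integrableOn_cube c r)
    (ae_of_all _ hw.nonneg)]

lemma wMeasure_cube_ne_top (hw : IsWeight w) (c : Fin n → ℝ) (r : ℝ) :
    wMeasure w (closedBall c r) ≠ ∞ := by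
  rw [hw.wMeasure_cube_eq]
  exact ENNReal.ofReal_ne_top

lemma wMeasure_cube_ne_zero (hw : IsWeight w) (c : Fin n → ℝ) {r : ℝ} (hr : 0 < r) :
    wMeasure w (closedBall c r) ≠ 0 := by
  intro h
  rw [wMeasure, withDensity_apply_eq_zero' hw.aemeasurable.ennreal_ofReal] at h
  refine volume_cube_ne_zero c hr (measure_mono_null_ae ?_ h)
  filter_upwards [hw.ae_pos] with x hx hxB
  exact ⟨by simpa using hx, hxB⟩

lemma lintegral_wMeasure (hw : IsWeight w) (g : (Fin n → ℝ) → ℝ≥0∞)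
    {s : Set (Fin n → ℝ)} (hs : MeasurableSet s) :
    ∫⁻ x in s, g x ∂(wMeasure w) = ∫⁻ x in s, g x * ENNReal.ofReal (w x) := by
  rw [wMeasure, setLIntegral_withDensity_eq_setLIntegral_mul_non_measurable₀ _
    hw.aemeasurable.ennreal_ofReal.restrict g hs (ae_of_all _ fun _ => ENNReal.ofReal_lt_top)]
  simp only [Pi.mul_apply, mul_comm]

end IsWeight

/-- `C` is a constant in the `A₁` inequality `w(B) / |B| ≤ C * w x`, for the cubes `B ∋ x`, with an
exceptional null set that does not depend on the cube. The inequality is cleared of denominators and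
stated in `[0, ∞]`. -/
def IsA1Bound (w : (Fin n → ℝ) → ℝ) (C : ℝ≥0) : Prop :=
  ∀ᵐ x, ∀ (c : Fin n → ℝ) (r : ℝ), 0 < r → x ∈ closedBall c r →
    wMeasure w (closedBall c r) ≤ C * volume (closedBall c r) * ENNReal.ofReal (w x)

/-- A common null set for all cubes is obtained from the countably many grid cubes. -/
lemma MemA1.exists_isA1Bound (hw : MemA1 w) : ∃ C : ℝ≥0, 1 ≤ C ∧ IsA1Bound w C := by
  obtain ⟨hw, C, hC0, hC⟩ := hw
  refine ⟨max 1 C.toNNReal, le_max_left _ _, ?_⟩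
  have h1 : ∀ i, ∀ᵐ x, x ∈ closedBall (gridCenter n i) (gridRadius i) →
      (volume (closedBall (gridCenter n i) (gridRadius i)))⁻¹ *
        wMeasure w (closedBall (gridCenter n i) (gridRadius i)) ≤
        ENNReal.ofReal C * ENNReal.ofReal (w x) := by
    intro i
    have hr := gridRadius_pos i
    have := hC _ (isCube_closedBall (gridCenter n i) hr)
    rw [ae_restrict_iff' isClosed_closedBall.measurableSet] at this
    filter_upwards [this] with x hx hxB
    have hx := hx hxB
    rw [setAverage_eq, smul_eq_mul] at hx
    rw [hw.wMeasure_cube_eq, ← ENNReal.ofReal_mul hC0.le]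
    refine le_trans (le_of_eq ?_) (ENNReal.ofReal_le_ofReal hx)
    rw [ENNReal.ofReal_mul (by positivity), measureReal_def, ENNReal.ofReal_inv_of_pos
      (ENNReal.toReal_pos (volume_cube_ne_zero _ hr) (volume_cube_ne_top _ hr)),
      ENNReal.ofReal_toReal (volume_cube_ne_top _ hr)]
  unfold IsA1Bound
  filter_upwards [ae_all_iff.2 h1] with x hx c r hr hxB
  have h2 := inv_volume_mul_le_of_grid (A := fun s => wMeasure w s) (fun s t h => measure_mono h)
    hx hr hxB
  calc wMeasure w (closedBall c r)
      = volume (closedBall c r) * ((volume (closedBall c r))⁻¹ * wMeasure w (closedBall c r)) := by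
        rw [← mul_assoc, ENNReal.mul_inv_cancel (volume_cube_ne_zero c hr)
          (volume_cube_ne_top c hr), one_mul]
    _ ≤ volume (closedBall c r) * (ENNReal.ofReal C * ENNReal.ofReal (w x)) := by gcongr
    _ = ENNReal.ofReal C * volume (closedBall c r) * ENNReal.ofReal (w x) := by ring
    _ ≤ _ := by
      gcongr
      exact ENNReal.coe_le_coe.2 (le_max_right 1 C.toNNReal)

variable {C : ℝ≥0}

/-- The measure form of the `A₁` inequality: `w(B) / |B| ≤ C w(S) / |S|` for `S ⊆ B`. -/
lemma volume_mul_wMeasure_le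
    (hC : IsA1Bound w C)
    {c : Fin n → ℝ} {r : ℝ} (hr : 0 < r) {S : Set (Fin n → ℝ)} (hS : MeasurableSet S)
    (hSB : S ⊆ closedBall c r) :
    volume S * wMeasure w (closedBall c r) ≤ C * volume (closedBall c r) * wMeasure w S := by
  calc volume S * wMeasure w (closedBall c r)
      = ∫⁻ _ in S, wMeasure w (closedBall c r) := by
        rw [setLIntegral_const, mul_comm]
    _ ≤ ∫⁻ x in S, C * volume (closedBall c r) * ENNReal.ofReal (w x) := by
        refine setLIntegral_mono_ae' hS ?_
        filter_upwards [hC] with x hx hxS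
        exact hx c r hr (hSB hxS)
    _ = _ := by
        rw [lintegral_const_mul' _ _ (ENNReal.mul_ne_top (by simp) (volume_cube_ne_top c hr)),
          ← wmeas_eq, wmeas]

/-- Doubling of the measure `w dx`. -/
lemma wMeasure_le_of_subset
    (hC : IsA1Bound w C)
    {c c' : Fin n → ℝ} {r : ℝ} (hr : 0 < r) (h : closedBall c' r ⊆ closedBall c (5 * r)) :
    wMeasure w (closedBall c (5 * r)) ≤ C * 5 ^ n * wMeasure w (closedBall c' r) := by
  have h1 := volume_mul_wMeasure_le hC (by positivity) isClosed_closedBall.measurableSet h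
  rw [volume_cube_mul c c' hr (by norm_num), ENNReal.ofReal_ofNat] at h1
  refine (ENNReal.mul_le_mul_iff_right (volume_cube_ne_zero c' hr) (volume_cube_ne_top c' hr)).1 ?_
  exact h1.trans_eq (by ring)

/-- Reverse doubling: halving a cube decreases the `w`-measure by a definite factor. -/
lemma exists_wMeasure_half_le (hn : n ≠ 0) (hw : IsWeight w) (hC1 : 1 ≤ C)
    (hC : IsA1Bound w C) :
    ∃ θ : ℝ≥0∞, θ < 1 ∧ ∀ (c c' : Fin n → ℝ) (r : ℝ), 0 < r →
      closedBall c' (r / 2) ⊆ closedBall c r →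
        wMeasure w (closedBall c' (r / 2)) ≤ θ * wMeasure w (closedBall c r) := by
  have hC0 : (C : ℝ≥0∞) ≠ 0 := by
    have : C ≠ 0 := (zero_lt_one.trans_le hC1).ne'
    exact_mod_cast this
  refine ⟨1 - (2 * (C : ℝ≥0∞))⁻¹, ENNReal.sub_lt_self (by simp) (by simp) (by simp; finiteness),
    fun c c' r hr h => ?_⟩
  set B := closedBall c r
  set B' := closedBall c' (r / 2)
  have hB' : MeasurableSet B' := isClosed_closedBall.measurableSet
  have hB : MeasurableSet B := isClosed_closedBall.measurableSet
  have hvol' : volume B' ≤ volume B / 2 := by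
    have : volume B' = ENNReal.ofReal (1 / 2) ^ n * volume B := by
      rw [← volume_cube_mul c' c hr (by norm_num)]
      rw [one_div_mul_eq_div]
    rw [this, ENNReal.div_eq_inv_mul]
    gcongr ?_ * volume B
    calc ENNReal.ofReal (1 / 2) ^ n ≤ ENNReal.ofReal (1 / 2) ^ 1 :=
          pow_le_pow_right_of_le_one' (by simp) (Nat.one_le_iff_ne_zero.2 hn)
      _ = 2⁻¹ := by
          rw [pow_one, one_div, ENNReal.ofReal_inv_of_pos (by norm_num), ENNReal.ofReal_ofNat]
  have hvol : volume B / 2 ≤ volume (B \ B') := by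
    rw [measure_sdiff h hB'.nullMeasurableSet (volume_cube_ne_top c' (by positivity))]
    refine ENNReal.le_sub_of_add_le_right (volume_cube_ne_top c' (by positivity)) ?_
    calc volume B / 2 + volume B' ≤ volume B / 2 + volume B / 2 := by gcongr
      _ = volume B := ENNReal.add_halves _
  have h1 : wMeasure w B ≤ 2 * C * wMeasure w (B \ B') := by
    refine (ENNReal.mul_le_mul_iff_right (volume_cube_ne_zero c hr)
      (volume_cube_ne_top c hr)).1 ?_
    calc volume B * wMeasure w B = 2 * (volume B / 2 * wMeasure w B) := by
          rw [← mul_assoc, ENNReal.mul_div_cancel (by simp) (by simp)]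
      _ ≤ 2 * (volume (B \ B') * wMeasure w B) := by gcongr
      _ ≤ 2 * (C * volume B * wMeasure w (B \ B')) := by
          gcongr 2 * ?_
          exact volume_mul_wMeasure_le hC hr (hB.diff hB') sdiff_subset
      _ = _ := by ring
  have h2 : (2 * (C : ℝ≥0∞))⁻¹ * wMeasure w B ≤ wMeasure w (B \ B') := by
    rwa [ENNReal.inv_mul_le_iff (by simp [hC0]) (by finiteness)]
  rw [ENNReal.sub_mul fun _ _ => hw.wMeasure_cube_ne_top c r, one_mul]
  refine ENNReal.le_sub_of_add_le_right
    (ne_top_of_le_ne_top (measure_ne_top_of_subset sdiff_subset (hw.wMeasure_cube_ne_top c r)) h2) ?_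
  calc wMeasure w B' + (2 * (C : ℝ≥0∞))⁻¹ * wMeasure w B
      ≤ wMeasure w B' + wMeasure w (B \ B') := by gcongr
    _ = wMeasure w B := by 
        rw [add_comm, ← measure_union disjoint_sdiff_left hB', sdiff_union_of_subset h]

end Weights

/-! ### Pointwise oscillation of weighted Lipschitz functions -/

section Oscillation

lemma enorm_setAverage_sub_le {X : Type*} [MeasurableSpace X] {μ : Measure X} {s : Set X}
    (h0 : μ s ≠ 0) (ht : μ s ≠ ∞) {f : X → ℝ} (hf : IntegrableOn f s μ) (m : ℝ) :
    ‖(⨍ y in s, f y ∂μ) - m‖ₑ ≤ (μ s)⁻¹ * ∫⁻ y in s, ‖f y - m‖ₑ ∂μ := by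
  have : Fact (μ s < ∞) := ⟨ht.lt_top⟩
  have : NeZero (μ.restrict s) := ⟨by simpa using h0⟩
  have hm : m = ⨍ _ in s, m ∂μ := (average_const _ _).symm
  conv_lhs => rw [hm]
  rw [average, average, ← integral_sub]
  · refine (enorm_integral_le_lintegral_enorm _).trans_eq ?_
    rw [lintegral_smul_measure, Measure.restrict_apply_univ, smul_eq_mul]
  · exact hf.to_average
  · exact integrable_const _

variable {n : ℕ} {w b : (Fin n → ℝ) → ℝ} {C : ℝ≥0}

/-- For `w ∈ A₁`, a function whose mean oscillation over each cube `B` is at most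
`L w(B) ^ (1 + s)` deviates from its mean over `B` by at most a multiple of `w x * w(B) ^ s`. The
means over a sequence of cubes that shrink to `x`, each half the previous one, converge to `b x`;
consecutive means differ by a term that decays geometrically, by reverse doubling. -/
lemma exists_ae_enorm_sub_average_le (hn : n ≠ 0) (hw : IsWeight w) (hC1 : 1 ≤ C)
    (hC : IsA1Bound w C)
    {s : ℝ} (hs : 0 < s) (hb : LocallyIntegrable b) {L : ℝ≥0}
    (hL : ∀ (c : Fin n → ℝ) (r : ℝ), 0 < r →
      ∫⁻ x in closedBall c r, ‖b x - ⨍ y in closedBall c r, b y‖ₑ ≤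
        L * (wMeasure w (closedBall c r) * wMeasure w (closedBall c r) ^ s)) :
    ∃ K : ℝ≥0, ∀ᵐ x, ∀ (c : Fin n → ℝ) (r : ℝ), 0 < r → x ∈ closedBall c r →
      ‖b x - ⨍ y in closedBall c r, b y‖ₑ ≤
        K * ENNReal.ofReal (w x) * wMeasure w (closedBall c r) ^ s := by
  obtain ⟨θ, hθ1, hθ⟩ := exists_wMeasure_half_le hn hw hC1 hC
  set K : ℝ≥0∞ := 2 ^ n * L * C * (1 - θ ^ s)⁻¹
  have hK : K ≠ ∞ := by
    have : 1 - θ ^ s ≠ 0 := (tsub_pos_of_lt (ENNReal.rpow_lt_one hθ1 hs)).ne'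
    finiteness
  lift K to ℝ≥0 using hK with K' hK'
  refine ⟨K', ?_⟩
  filter_upwards [hC, IsUnifLocDoublingMeasure.ae_tendsto_average volume hb 1] with x hx hlim c r hr hxB
  -- moving the centre halfway towards `x` and halving the radius yields a nested sequence of cubes,
  -- all of which contain `x`
  set ck : ℕ → (Fin n → ℝ) := fun k => x + ((1 / 2 : ℝ) ^ k) • (c - x)
  set rk : ℕ → ℝ := fun k => r * (1 / 2) ^ k
  have hrk : ∀ k, 0 < rk k := fun k => by positivity
  have hrk1 : ∀ k, rk (k + 1) = rk k / 2 := fun k => by simp only [rk]; ring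
  have hcx : ‖c - x‖ ≤ r := by rwa [mem_closedBall, dist_comm, dist_eq_norm] at hxB
  have hxk : ∀ k, x ∈ closedBall (ck k) (rk k) := by
    intro k
    rw [mem_closedBall, dist_comm, dist_eq_norm]
    simp only [ck, rk, add_sub_cancel_left, norm_smul, norm_pow]
    rw [mul_comm, Real.norm_of_nonneg (by norm_num)]
    gcongr
  have hsub : ∀ k, closedBall (ck (k + 1)) (rk k / 2) ⊆ closedBall (ck k) (rk k) := by
    intro k
    refine closedBall_subset_closedBall' ?_
    have : dist (ck (k + 1)) (ck k) ≤ rk k / 2 := by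
      rw [dist_eq_norm]
      have e : ck (k + 1) - ck k = -((1 / 2 : ℝ) ^ (k + 1)) • (c - x) := by
        simp only [ck]
        rw [add_sub_add_left_eq_sub, ← sub_smul]
        congr 1
        ring
      rw [e, norm_smul, norm_neg, norm_pow, Real.norm_of_nonneg (by norm_num), ← hrk1]
      simp only [rk]
      rw [mul_comm]
      gcongr
    linarith
  have hν : ∀ k, wMeasure w (closedBall (ck k) (rk k)) ≤ θ ^ k * wMeasure w (closedBall c r) := by
    intro k
    induction k with
    | zero => simp [ck, rk]
    | succ k ih =>
      rw [hrk1]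
      calc _ ≤ θ * wMeasure w (closedBall (ck k) (rk k)) := hθ _ _ _ (hrk k) (hsub k)
        _ ≤ θ * (θ ^ k * wMeasure w (closedBall c r)) := by gcongr
        _ = _ := by ring
  have hδ : Tendsto rk atTop (𝓝[>] 0) := by
    refine tendsto_nhdsWithin_iff.2 ⟨?_, Eventually.of_forall hrk⟩
    have := (tendsto_pow_atTop_nhds_zero_of_lt_one (by norm_num : (0 : ℝ) ≤ 1 / 2)
      (by norm_num)).const_mul r
    rwa [mul_zero] at this
  have hconv := hlim ck rk hδ (Eventually.of_forall fun k => by simpa using hxk k)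
  have hstep : ∀ k, edist (⨍ y in closedBall (ck k) (rk k), b y)
      (⨍ y in closedBall (ck k.succ) (rk k.succ), b y) ≤
      2 ^ n * L * C * ENNReal.ofReal (w x) * wMeasure w (closedBall c r) ^ s * (θ ^ s) ^ k := by
    intro k
    set B := closedBall (ck k) (rk k)
    have hB0 := volume_cube_ne_zero (ck k) (hrk k)
    have hBt := volume_cube_ne_top (ck k) (hrk k)
    have hvol : volume B = 2 ^ n * volume (closedBall (ck (k + 1)) (rk (k + 1))) := by
      rw [← ENNReal.ofReal_ofNat 2, ← volume_cube_mul (ck k) _ (hrk (k + 1)) (by norm_num), hrk1,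
        mul_div_cancel₀ _ two_ne_zero]
    rw [edist_comm, edist_eq_enorm_sub]
    calc _ ≤ (volume (closedBall (ck (k + 1)) (rk (k + 1))))⁻¹ *
            ∫⁻ y in closedBall (ck (k + 1)) (rk (k + 1)), ‖b y - ⨍ y in B, b y‖ₑ :=
          enorm_setAverage_sub_le (volume_cube_ne_zero _ (hrk _)) (volume_cube_ne_top _ (hrk _))
            (hb.integrableOn_isCompact (isCompact_closedBall _ _)) _
      _ = 2 ^ n * (volume B)⁻¹ *
            ∫⁻ y in closedBall (ck (k + 1)) (rk (k + 1)), ‖b y - ⨍ y in B, b y‖ₑ := by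
          rw [hvol, ENNReal.mul_inv (by simp) (by simp), ← mul_assoc,
            ENNReal.mul_inv_cancel (by simp) (by simp), one_mul]
      _ ≤ 2 ^ n * (volume B)⁻¹ * ∫⁻ y in B, ‖b y - ⨍ y in B, b y‖ₑ := by
          gcongr 2 ^ n * (volume B)⁻¹ * ?_
          refine lintegral_mono_set ?_
          rw [hrk1]
          exact hsub k
      _ ≤ 2 ^ n * (volume B)⁻¹ * (L * ((C * volume B * ENNReal.ofReal (w x)) *
            (θ ^ k * wMeasure w (closedBall c r)) ^ s)) := by
          refine mul_le_mul_right ((hL _ _ (hrk k)).trans ?_) _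
          gcongr
          · exact hx _ _ (hrk k) (hxk k)
          · exact hν k
      _ = ((volume B)⁻¹ * volume B) * (2 ^ n * L * C * ENNReal.ofReal (w x) *
            wMeasure w (closedBall c r) ^ s * (θ ^ s) ^ k) := by
          rw [ENNReal.mul_rpow_of_nonneg _ _ hs.le, ← ENNReal.rpow_natCast_mul, mul_comm (k : ℝ) s,
            ENNReal.rpow_mul_natCast]
          ring
      _ = _ := by rw [ENNReal.inv_mul_cancel hB0 hBt, one_mul]
  have hfin := edist_le_tsum_of_edist_le_of_tendsto₀ _ hstep hconv
  rw [ENNReal.tsum_mul_left, ENNReal.tsum_geometric, edist_comm, edist_eq_enorm_sub] at hfin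
  have e0 : closedBall (ck 0) (rk 0) = closedBall c r := by simp [ck, rk]
  rw [e0] at hfin
  refine hfin.trans_eq ?_
  rw [hK']
  ring

end Oscillation

/-! ### Domination of the maximal commutator by a fractional maximal function -/

section Commutator

variable {n : ℕ} {w b f : (Fin n → ℝ) → ℝ} {C : ℝ≥0}

lemma maximalCommutator_le_iff {x : Fin n → ℝ} {S : ℝ≥0∞} :
    maximalCommutator b f x ≤ S ↔ ∀ (c : Fin n → ℝ) (r : ℝ), 0 < r → x ∈ closedBall c r →
      (volume (closedBall c r))⁻¹ * ∫⁻ y in closedBall c r, ‖b x - b y‖ₑ * ‖f y‖ₑ ≤ S := by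
  simp only [maximalCommutator, iSup_le_iff]
  constructor
  · intro h c r hr hx
    exact h _ (isCube_closedBall c hr) hx
  · rintro h Q hQ hx
    obtain ⟨c, r, hr, rfl⟩ := isCube_iff.1 hQ
    exact h c r hr hx

/-- The supremum may be taken over the grid cubes, after replacing `b` and `f` by measurable
versions; each term is then measurable by Tonelli's theorem. -/
lemma aemeasurable_maximalCommutator (hb : AEMeasurable b) (hf : AEMeasurable f) :
    AEMeasurable (maximalCommutator b f) := by
  set b' := hb.mk b
  set f' := hf.mk f
  have hb' : Measurable b' := hb.measurable_mk
  have hf' : Measurable f' := hf.measurable_mk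
  refine ⟨fun x => ⨆ i, (closedBall (gridCenter n i) (gridRadius i)).indicator
    (fun x => (volume (closedBall (gridCenter n i) (gridRadius i)))⁻¹ *
      ∫⁻ y in closedBall (gridCenter n i) (gridRadius i), ‖b' x - b' y‖ₑ * ‖f' y‖ₑ) x, ?_, ?_⟩
  · refine Measurable.iSup fun i => Measurable.indicator ?_ isClosed_closedBall.measurableSet
    refine Measurable.const_mul (Measurable.lintegral_prod_right' (f := fun z : (Fin n → ℝ) ×
      (Fin n → ℝ) => ‖b' z.1 - b' z.2‖ₑ * ‖f' z.2‖ₑ) ?_) _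
    fun_prop
  · filter_upwards [hb.ae_eq_mk] with x hx
    have hint : ∀ s : Set (Fin n → ℝ), ∫⁻ y in s, ‖b' x - b' y‖ₑ * ‖f' y‖ₑ =
        ∫⁻ y in s, ‖b x - b y‖ₑ * ‖f y‖ₑ := by
      intro s
      refine lintegral_congr_ae (ae_restrict_of_ae ?_)
      filter_upwards [hb.ae_eq_mk, hf.ae_eq_mk] with y h1 h2
      rw [hx, h1, h2]
    apply le_antisymm
    · refine maximalCommutator_le_iff.2 fun c r hr hxB => ?_
      refine inv_volume_mul_le_of_grid (A := fun s => ∫⁻ y in s, ‖b x - b y‖ₑ * ‖f y‖ₑ)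
        (fun s t h => lintegral_mono_set h) (fun i hi => ?_) hr hxB
      refine le_trans (le_of_eq ?_) (le_iSup _ i)
      rw [indicator_of_mem hi, hint]
    · refine iSup_le fun i => ?_
      by_cases hi : x ∈ closedBall (gridCenter n i) (gridRadius i)
      · rw [indicator_of_mem hi, hint]
        exact maximalCommutator_le_iff.1 le_rfl _ _ (gridRadius_pos i) hi
      · rw [indicator_of_notMem hi]
        exact zero_le

/-- The fractional maximal function of order `s` with respect to the measure `w dx`: the supremum
over the cubes `B ∋ x` of `w(B) ^ (s - 1) * ∫_B |f| w`. -/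
noncomputable def fracMaximal (w : (Fin n → ℝ) → ℝ) (s : ℝ) (f : (Fin n → ℝ) → ℝ)
    (x : Fin n → ℝ) : ℝ≥0∞ :=
  ⨆ (c : Fin n → ℝ) (r : ℝ) (_ : 0 < r) (_ : x ∈ closedBall c r),
    wMeasure w (closedBall c r) ^ s * ((wMeasure w (closedBall c r))⁻¹ *
      ∫⁻ y in closedBall c r, ‖f y‖ₑ ∂(wMeasure w))

lemma fracMaximal_le_iff {s : ℝ} {x : Fin n → ℝ} {S : ℝ≥0∞} :
    fracMaximal w s f x ≤ S ↔ ∀ (c : Fin n → ℝ) (r : ℝ), 0 < r → x ∈ closedBall c r →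
      wMeasure w (closedBall c r) ^ s * ((wMeasure w (closedBall c r))⁻¹ *
        ∫⁻ y in closedBall c r, ‖f y‖ₑ ∂(wMeasure w)) ≤ S := by
  simp only [fracMaximal, iSup_le_iff]

/-- The maximal commutator is dominated by `w` times the fractional maximal function of order `s`
taken with respect to the measure `w dx`. -/
lemma ae_maximalCommutator_le (hw : IsWeight w)
    (hC : IsA1Bound w C)
    {s : ℝ} {K : ℝ≥0}
    (hK : ∀ᵐ x, ∀ (c : Fin n → ℝ) (r : ℝ), 0 < r → x ∈ closedBall c r →
      ‖b x - ⨍ y in closedBall c r, b y‖ₑ ≤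
        K * ENNReal.ofReal (w x) * wMeasure w (closedBall c r) ^ s)
    (hf : AEMeasurable f) :
    ∀ᵐ x, maximalCommutator b f x ≤ 2 * K * C * ENNReal.ofReal (w x) * fracMaximal w s f x := by
  filter_upwards [hC, hK] with x hCx hKx
  refine maximalCommutator_le_iff.2 fun c r hr hxB => ?_
  set B := closedBall c r
  have hBm : MeasurableSet B := isClosed_closedBall.measurableSet
  set V := volume B
  set N := wMeasure w B
  have hV0 : V ≠ 0 := volume_cube_ne_zero c hr
  have hVt : V ≠ ∞ := volume_cube_ne_top c hr
  have hN0 : N ≠ 0 := hw.wMeasure_cube_ne_zero c hr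
  have hNt : N ≠ ∞ := hw.wMeasure_cube_ne_top c r
  have hVinv : ∀ z : ℝ≥0∞, N ≤ C * V * z → V⁻¹ ≤ C * z * N⁻¹ := by
    intro z hz
    rw [← div_eq_mul_inv, ENNReal.le_div_iff_mul_le (Or.inl hN0) (Or.inl hNt), mul_comm,
      ← div_eq_mul_inv]
    refine ENNReal.div_le_of_le_mul (hz.trans_eq (by ring))
  set F := ∫⁻ y in B, ‖f y‖ₑ ∂(wMeasure w)
  have hF : F = ∫⁻ y in B, ‖f y‖ₑ * ENNReal.ofReal (w y) :=
    hw.lintegral_wMeasure _ hBm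
  have h1 : V⁻¹ * ∫⁻ y in B, ‖f y‖ₑ ≤ C * (N⁻¹ * F) := by
    rw [hF, ← lintegral_const_mul' _ _ (by simp [hV0]), ← lintegral_const_mul' _ _ (by simp [hN0]),
      ← lintegral_const_mul' _ _ (by simp)]
    refine setLIntegral_mono_ae' hBm ?_
    filter_upwards [hC] with y hy hyB
    calc V⁻¹ * ‖f y‖ₑ ≤ (C * ENNReal.ofReal (w y) * N⁻¹) * ‖f y‖ₑ := by
          gcongr
          exact hVinv _ (hy c r hr hyB)
      _ = _ := by ring
  have h2 : V⁻¹ * F ≤ C * ENNReal.ofReal (w x) * N⁻¹ * F := by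
    gcongr
    exact hVinv _ (hCx c r hr hxB)
  have hNs : N ^ s ≠ ∞ := by
    simp [ENNReal.rpow_eq_top_iff, hN0, hNt]
  calc V⁻¹ * ∫⁻ y in B, ‖b x - b y‖ₑ * ‖f y‖ₑ
      ≤ V⁻¹ * ∫⁻ y in B, K * N ^ s *
          (ENNReal.ofReal (w x) * ‖f y‖ₑ + ‖f y‖ₑ * ENNReal.ofReal (w y)) := by
        gcongr V⁻¹ * ?_
        refine setLIntegral_mono_ae' hBm ?_
        filter_upwards [hK] with y hy hyB
        calc ‖b x - b y‖ₑ * ‖f y‖ₑ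
            ≤ (‖b x - ⨍ z in B, b z‖ₑ + ‖b y - ⨍ z in B, b z‖ₑ) * ‖f y‖ₑ := by
              gcongr
              rw [← edist_eq_enorm_sub, ← edist_eq_enorm_sub, ← edist_eq_enorm_sub]
              exact edist_triangle_right _ _ _
          _ ≤ (K * ENNReal.ofReal (w x) * N ^ s + K * ENNReal.ofReal (w y) * N ^ s) * ‖f y‖ₑ := by
              gcongr
              · exact hKx c r hr hxB
              · exact hy c r hr hyB
          _ = _ := by ring
    _ = K * N ^ s * (ENNReal.ofReal (w x) * (V⁻¹ * ∫⁻ y in B, ‖f y‖ₑ) + V⁻¹ * F) := by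
        rw [lintegral_const_mul' _ _ (by finiteness), lintegral_add_left' (by fun_prop),
          lintegral_const_mul' _ _ (by simp), ← hF]
        ring
    _ ≤ K * N ^ s * (ENNReal.ofReal (w x) * (C * (N⁻¹ * F)) +
          C * ENNReal.ofReal (w x) * N⁻¹ * F) := by gcongr
    _ = 2 * K * C * ENNReal.ofReal (w x) * (N ^ s * (N⁻¹ * F)) := by ring
    _ ≤ _ := by
        gcongr
        exact fracMaximal_le_iff.1 le_rfl c r hr hxB

end Commutator

/-! ### The fractional maximal function on Morrey spaces -/

section Fractional

variable {n : ℕ} {w f : (Fin n → ℝ) → ℝ} {C : ℝ≥0}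

/-- Hölder's inequality against the constant function `1`. -/
lemma setLIntegral_le_rpow_mul_measure_rpow {X : Type*} [MeasurableSpace X] {μ : Measure X}
    {g : X → ℝ≥0∞} (hg : AEMeasurable g μ) (s : Set X) {p : ℝ} (hp : 1 < p) :
    ∫⁻ y in s, g y ∂μ ≤ (∫⁻ y in s, g y ^ p ∂μ) ^ (1 / p) * μ s ^ (1 - 1 / p) := by
  have hpq := Real.HolderConjugate.conjExponent hp
  have h := ENNReal.lintegral_mul_le_Lp_mul_Lq (μ.restrict s) hpq hg.restrict
    (aemeasurable_const (b := (1 : ℝ≥0∞)))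
  simp only [Pi.mul_apply, mul_one, ENNReal.one_rpow, lintegral_const, one_mul,
    Measure.restrict_apply_univ] at h
  have e : 1 / p.conjExponent = 1 - 1 / p := by
    rw [one_div, one_div, ← hpq.one_sub_inv]
  rwa [e] at h

/-- Hedberg's inequality: Hölder's inequality on a set of measure `v` bounds the fractional mean
`v ^ (s - 1) * A` by a product of powers of the mean `v⁻¹ * A` and of the `p`-th power integral
`G`. -/
lemma rpow_mul_inv_mul_le {p q s : ℝ} (hp : 1 < p) (hpq : p < q) (hs : 1 / q = 1 / p - s)
    {v A G : ℝ≥0∞} (hv0 : v ≠ 0) (hvt : v ≠ ∞) (hA : A ≤ G ^ (1 / p) * v ^ (1 - 1 / p)) :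
    v ^ s * (v⁻¹ * A) ≤ (v⁻¹ * A) ^ (p / q) * G ^ (1 / p - 1 / q) := by
  have hp0 : 0 < p := by linarith
  have hq0 : 0 < q := by linarith
  have hpq0 : 0 ≤ p / q := by positivity
  have hpq1 : 0 ≤ 1 - p / q := sub_nonneg.2 ((div_le_one hq0).2 hpq.le)
  have eA : A = A ^ (p / q) * A ^ (1 - p / q) := by
    rw [← ENNReal.rpow_add_of_nonneg _ _ hpq0 hpq1, add_sub_cancel, ENNReal.rpow_one]
  calc v ^ s * (v⁻¹ * A) = v ^ s * v⁻¹ * A ^ (p / q) * A ^ (1 - p / q) := by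
        conv_lhs => rw [eA]
        ring
    _ ≤ v ^ s * v⁻¹ * A ^ (p / q) * (G ^ (1 / p) * v ^ (1 - 1 / p)) ^ (1 - p / q) := by gcongr
    _ = (v ^ s * v ^ (-1 : ℝ) * v ^ ((1 - 1 / p) * (1 - p / q))) * A ^ (p / q) *
          G ^ (1 / p - 1 / q) := by
        rw [ENNReal.mul_rpow_of_nonneg _ _ hpq1, ← ENNReal.rpow_mul, ← ENNReal.rpow_mul,
          ENNReal.rpow_neg_one]
        have : 1 / p * (1 - p / q) = 1 / p - 1 / q := by field_simp
        rw [this]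
        ring
    _ = v ^ (-(p / q)) * A ^ (p / q) * G ^ (1 / p - 1 / q) := by
        rw [← ENNReal.rpow_add _ _ hv0 hvt, ← ENNReal.rpow_add _ _ hv0 hvt]
        have : s + -1 + (1 - 1 / p) * (1 - p / q) = -(p / q) := by
          have : s = 1 / p - 1 / q := by linarith
          rw [this]
          field_simp
          ring
        rw [this]
    _ = _ := by
        rw [ENNReal.mul_rpow_of_nonneg _ _ hpq0, ENNReal.rpow_neg, ENNReal.inv_rpow]

/-- The mean of `g` over any cube that contains `x` is controlled by the maximal function over the
countable family of grid cubes. -/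
lemma inv_mul_le_ballMaximal (hw : IsWeight w)
    (hC : IsA1Bound w C)
    (g : (Fin n → ℝ) → ℝ≥0∞) {x c : Fin n → ℝ} {r : ℝ} (hr : 0 < r) (hx : x ∈ closedBall c r) :
    (wMeasure w (closedBall c r))⁻¹ * ∫⁻ y in closedBall c r, g y ∂(wMeasure w) ≤
      C * 5 ^ n * ballMaximal (wMeasure w) (gridCenter n) gridRadius g x := by
  obtain ⟨i, hi, hir⟩ := exists_grid_cube c hr hr
  have hsub : closedBall (gridCenter n i) (gridRadius i) ⊆ closedBall c (5 * r) := by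
    refine closedBall_subset_closedBall' ?_
    have : dist c (gridCenter n i) ≤ gridRadius i := hi (mem_closedBall_self hr.le)
    rw [dist_comm] at this
    linarith
  have hN : wMeasure w (closedBall (gridCenter n i) (gridRadius i)) ≤
      C * 5 ^ n * wMeasure w (closedBall c r) :=
    (measure_mono hsub).trans (wMeasure_le_of_subset hC hr
      (closedBall_subset_closedBall (by linarith)))
  have hinv : (wMeasure w (closedBall c r))⁻¹ ≤
      C * 5 ^ n * (wMeasure w (closedBall (gridCenter n i) (gridRadius i)))⁻¹ := by
    rw [← div_eq_mul_inv, ENNReal.le_div_iff_mul_le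
      (Or.inl (hw.wMeasure_cube_ne_zero _ (gridRadius_pos i)))
      (Or.inl (hw.wMeasure_cube_ne_top _ _)), mul_comm, ← div_eq_mul_inv]
    exact ENNReal.div_le_of_le_mul hN
  calc _ ≤ C * 5 ^ n * (wMeasure w (closedBall (gridCenter n i) (gridRadius i)))⁻¹ *
        ∫⁻ y in closedBall (gridCenter n i) (gridRadius i), g y ∂(wMeasure w) :=
        mul_le_mul' hinv (lintegral_mono_set hi)
    _ ≤ _ := by
        rw [mul_assoc]
        gcongr
        refine le_trans (le_of_eq ?_) (le_iSup _ i)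
        rw [indicator_of_mem (hi hx)]

/-- The local form of the boundedness of the fractional maximal operator on Morrey spaces. On the
cube `closedBall c₀ r₀`, cubes of half side at least `r₀` are handled by the Morrey condition
alone, and smaller ones, which lie in `closedBall c₀ (5 * r₀)`, by Hedberg's inequality and the
maximal inequality for the restriction of `f` to that cube. -/
lemma exists_setLIntegral_fracMaximal_le (hw : IsWeight w) (hC1 : 1 ≤ C)
    (hC : IsA1Bound w C)
    {p q s κ : ℝ} (hp : 1 < p) (hpq : p < q) (hs : 1 / q = 1 / p - s) (hκ0 : 0 < κ)
    (hκ : κ < p / q) :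
    ∃ K : ℝ≥0, ∀ (f : (Fin n → ℝ) → ℝ) (N : ℝ≥0∞), AEMeasurable f →
      (∀ (c : Fin n → ℝ) (r : ℝ), 0 < r → ∫⁻ y in closedBall c r, ‖f y‖ₑ ^ p ∂(wMeasure w) ≤
        wMeasure w (closedBall c r) ^ κ * N ^ p) →
      ∀ (c₀ : Fin n → ℝ) (r₀ : ℝ), 0 < r₀ →
        ∫⁻ x in closedBall c₀ r₀, fracMaximal w s f x ^ q ∂(wMeasure w) ≤
          K * (wMeasure w (closedBall c₀ r₀) ^ (κ * q / p) * N ^ q) := by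
  have hp0 : 0 < p := by linarith
  have hq0 : 0 < q := by linarith
  set ν := wMeasure w
  set D : ℝ≥0∞ := C * 5 ^ n
  have hD0 : D ≠ 0 := by
    have : C ≠ 0 := (zero_lt_one.trans_le hC1).ne'
    simp [D, this]
  have hDt : D ≠ ∞ := by finiteness
  set e : ℝ := κ / p - 1 / q
  have he : e < 0 := by
    have : κ / p < 1 / q := by
      rw [div_lt_div_iff₀ hp0 hq0, one_mul]
      rwa [lt_div_iff₀ hq0] at hκ
    simp only [e]
    linarith
  set Cp : ℝ≥0∞ := ENNReal.ofReal p * (ENNReal.ofReal (p - 1))⁻¹ * 2 ^ p * D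
  have hCpt : Cp ≠ ∞ := by
    have : ENNReal.ofReal (p - 1) ≠ 0 := by simpa using hp
    finiteness
  set K : ℝ≥0∞ := D ^ (-(e * q)) + D ^ p * Cp * D ^ (κ * q / p)
  have hK : K ≠ ∞ := by finiteness
  lift K to ℝ≥0 using hK with K' hK'
  refine ⟨K', fun f N hf hN c₀ r₀ hr₀ => ?_⟩
  rw [hK']
  set B₀ := closedBall c₀ r₀
  set B₅ := closedBall c₀ (5 * r₀)
  have hB₅ : MeasurableSet B₅ := isClosed_closedBall.measurableSet
  set V := ν B₀
  have hV0 : V ≠ 0 := hw.wMeasure_cube_ne_zero c₀ hr₀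
  have hVt : V ≠ ∞ := hw.wMeasure_cube_ne_top c₀ r₀
  have hfν : AEMeasurable f ν := hf.mono_ac (wMeasure_absolutelyContinuous w)
  set f' := hfν.mk f
  have hf' : Measurable f' := hfν.measurable_mk
  set g : (Fin n → ℝ) → ℝ≥0 := B₅.indicator fun y => ‖f' y‖₊
  have hg : Measurable g := hf'.nnnorm.indicator hB₅
  have hgf : ∀ᵐ y ∂ν, y ∈ B₅ → (g y : ℝ≥0∞) = ‖f y‖ₑ := by
    filter_upwards [hfν.ae_eq_mk] with y hy hyB
    simp only [g]
    rw [indicator_of_mem hyB, hy]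
    rfl
  set G := ∫⁻ y, (g y : ℝ≥0∞) ^ p ∂ν
  have hG : G ≤ (D * V) ^ κ * N ^ p := by
    have e1 : G = ∫⁻ y in B₅, ‖f y‖ₑ ^ p ∂ν := by
      rw [← lintegral_indicator hB₅]
      refine lintegral_congr_ae ?_
      filter_upwards [hgf] with y hy
      by_cases hyB : y ∈ B₅
      · rw [indicator_of_mem hyB, hy hyB]
      · simp [g, indicator_of_notMem hyB, hp0]
    rw [e1]
    refine (hN c₀ (5 * r₀) (by positivity)).trans ?_
    gcongr
    exact wMeasure_le_of_subset hC hr₀ (closedBall_subset_closedBall (by linarith))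
  set M := ballMaximal ν (gridCenter n) gridRadius (fun y => (g y : ℝ≥0∞))
  have hM : Measurable M := measurable_ballMaximal _ _ _ _
  have hMint : ∫⁻ x, M x ^ p ∂ν ≤ Cp * G :=
    lintegral_ballMaximal_rpow_le ν _ _ hg hp D fun i =>
      wMeasure_le_of_subset hC (gridRadius_pos i)
        (closedBall_subset_closedBall (by linarith [gridRadius_pos i]))
  have hpt : ∀ x ∈ B₀, fracMaximal w s f x ≤
      max (D ^ (-e) * V ^ e * N) ((D * M x) ^ (p / q) * G ^ (1 / p - 1 / q)) := by
    intro x hx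
    refine fracMaximal_le_iff.2 fun c r hr hxB => ?_
    set B := closedBall c r
    have hv0 : ν B ≠ 0 := hw.wMeasure_cube_ne_zero c hr
    have hvt : ν B ≠ ∞ := hw.wMeasure_cube_ne_top c r
    have hdist : dist c c₀ ≤ r + r₀ := by
      rw [mem_closedBall] at hxB hx
      linarith [dist_triangle_left c c₀ x]
    -- large cubes: `e < 0`, so that `w(B) ^ e` is controlled by `w(B₀) ^ e`
    rcases le_or_gt r₀ r with hrr | hrr
    · refine le_max_of_le_left ?_
      have hsub : B₀ ⊆ closedBall c (5 * r) := by
        refine closedBall_subset_closedBall' ?_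
        rw [dist_comm]
        linarith
      have hVB : V ≤ D * ν B := (measure_mono hsub).trans (wMeasure_le_of_subset hC hr
        (closedBall_subset_closedBall (by linarith)))
      calc ν B ^ s * ((ν B)⁻¹ * ∫⁻ y in B, ‖f y‖ₑ ∂ν)
          ≤ ν B ^ s * ((ν B)⁻¹ * ((ν B ^ κ * N ^ p) ^ (1 / p) * ν B ^ (1 - 1 / p))) := by
            gcongr
            refine (setLIntegral_le_rpow_mul_measure_rpow hfν.enorm B hp).trans ?_
            gcongr
            exact hN c r hr
        _ = ν B ^ s * ν B ^ (-1 : ℝ) * ν B ^ (κ * (1 / p)) * ν B ^ (1 - 1 / p) * N := by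
            rw [ENNReal.mul_rpow_of_nonneg _ _ (by positivity), ← ENNReal.rpow_mul,
              ← ENNReal.rpow_mul, mul_one_div_cancel hp0.ne', ENNReal.rpow_one,
              ENNReal.rpow_neg_one]
            ring
        _ = ν B ^ e * N := by
            rw [← ENNReal.rpow_add _ _ hv0 hvt, ← ENNReal.rpow_add _ _ hv0 hvt,
              ← ENNReal.rpow_add _ _ hv0 hvt]
            congr 2
            simp only [e]
            rw [hs]
            ring
        _ ≤ (D⁻¹ * V) ^ e * N := by
            gcongr ?_ * N
            rw [← neg_neg e, ENNReal.rpow_neg, ENNReal.rpow_neg _ (-e), ENNReal.inv_le_inv]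
            refine ENNReal.rpow_le_rpow ?_ (by linarith)
            rwa [ENNReal.inv_mul_le_iff hD0 hDt]
        _ = D ^ (-e) * V ^ e * N := by
            rw [ENNReal.mul_rpow_of_ne_zero (by simpa using hDt) hV0, ENNReal.inv_rpow,
              ENNReal.rpow_neg]
    -- small cubes: these lie in `B₅`, where `f` agrees with `g`
    · refine le_max_of_le_right ?_
      have hsub : B ⊆ B₅ := by
        refine closedBall_subset_closedBall' ?_
        linarith
      have e1 : ∫⁻ y in B, ‖f y‖ₑ ∂ν = ∫⁻ y in B, g y ∂ν := by
        refine setLIntegral_congr_fun_ae isClosed_closedBall.measurableSet ?_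
        filter_upwards [hgf] with y hy hyB
        exact (hy (hsub hyB)).symm
      rw [e1]
      refine (rpow_mul_inv_mul_le hp hpq hs hv0 hvt (G := G) ?_).trans ?_
      · refine (setLIntegral_le_rpow_mul_measure_rpow
          hg.coe_nnreal_ennreal.aemeasurable B hp).trans ?_
        gcongr ?_ ^ _ * _
        exact setLIntegral_le_lintegral _ _
      · gcongr ?_ ^ _ * _
        exact inv_mul_le_ballMaximal hw hC _ hr hxB
  have hpq0 : 0 ≤ 1 / p - 1 / q := sub_nonneg.2 (one_div_le_one_div_of_le hp0 hpq.le)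
  have hfar : ∫⁻ _ in B₀, (D ^ (-e) * V ^ e * N) ^ q ∂ν =
      D ^ (-(e * q)) * (V ^ (κ * q / p) * N ^ q) := by
    rw [setLIntegral_const, ENNReal.mul_rpow_of_nonneg _ _ hq0.le,
      ENNReal.mul_rpow_of_nonneg _ _ hq0.le, ← ENNReal.rpow_mul, ← ENNReal.rpow_mul, neg_mul]
    have : V ^ (κ * q / p) = V ^ (e * q) * V := by
      conv_rhs => rw [← ENNReal.rpow_one (x := V), ← ENNReal.rpow_mul, one_mul]
      rw [← ENNReal.rpow_add _ _ hV0 hVt]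
      congr 1
      simp only [e]
      field_simp
      ring
    rw [this]
    ring
  have hnear : ∫⁻ x in B₀, ((D * M x) ^ (p / q) * G ^ (1 / p - 1 / q)) ^ q ∂ν ≤
      D ^ p * Cp * D ^ (κ * q / p) * (V ^ (κ * q / p) * N ^ q) := by
    calc ∫⁻ x in B₀, ((D * M x) ^ (p / q) * G ^ (1 / p - 1 / q)) ^ q ∂ν
        ≤ ∫⁻ x, ((D * M x) ^ (p / q) * G ^ (1 / p - 1 / q)) ^ q ∂ν := by
          gcongr
          exact Measure.restrict_le_self
      _ = ∫⁻ x, D ^ p * G ^ (q / p - 1) * M x ^ p ∂ν := by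
          refine lintegral_congr fun x => ?_
          rw [ENNReal.mul_rpow_of_nonneg _ _ hq0.le, ← ENNReal.rpow_mul, ← ENNReal.rpow_mul,
            div_mul_cancel₀ _ hq0.ne', ENNReal.mul_rpow_of_nonneg _ _ hp0.le]
          have : (1 / p - 1 / q) * q = q / p - 1 := by field_simp
          rw [this]
          ring
      _ = D ^ p * G ^ (q / p - 1) * ∫⁻ x, M x ^ p ∂ν :=
          lintegral_const_mul _ (hM.pow_const p)
      _ ≤ D ^ p * G ^ (q / p - 1) * (Cp * G) := by gcongr
      _ = D ^ p * Cp * G ^ (q / p) := by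
          have h1 : 0 ≤ q / p - 1 := sub_nonneg.2 ((one_le_div hp0).2 hpq.le)
          have : G ^ (q / p) = G ^ (q / p - 1) * G := by
            conv_rhs => rw [← ENNReal.rpow_one (x := G), ← ENNReal.rpow_mul, one_mul]
            rw [← ENNReal.rpow_add_of_nonneg _ _ h1 zero_le_one, sub_add_cancel]
          rw [this]
          ring
      _ ≤ D ^ p * Cp * ((D * V) ^ κ * N ^ p) ^ (q / p) := by gcongr
      _ = _ := by
          have : ((D * V) ^ κ * N ^ p) ^ (q / p) = D ^ (κ * q / p) * (V ^ (κ * q / p) * N ^ q) := by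
            rw [ENNReal.mul_rpow_of_nonneg _ _ (by positivity), ← ENNReal.rpow_mul,
              ← ENNReal.rpow_mul, mul_div_cancel₀ _ hp0.ne', ← mul_div_assoc,
              ENNReal.mul_rpow_of_nonneg _ _ (by positivity), mul_assoc]
          rw [this]
          ring
  calc ∫⁻ x in B₀, fracMaximal w s f x ^ q ∂ν
      ≤ ∫⁻ x in B₀, ((D ^ (-e) * V ^ e * N) ^ q +
          ((D * M x) ^ (p / q) * G ^ (1 / p - 1 / q)) ^ q) ∂ν := by
        refine setLIntegral_mono' isClosed_closedBall.measurableSet fun x hx => ?_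
        rcases le_max_iff.1 (hpt x hx) with h | h
        · exact (ENNReal.rpow_le_rpow h hq0.le).trans le_self_add
        · exact (ENNReal.rpow_le_rpow h hq0.le).trans le_add_self
    _ ≤ D ^ (-(e * q)) * (V ^ (κ * q / p) * N ^ q) +
          D ^ p * Cp * D ^ (κ * q / p) * (V ^ (κ * q / p) * N ^ q) := by
        rw [lintegral_add_left measurable_const, hfar]
        gcongr
    _ = K * (V ^ (κ * q / p) * N ^ q) := by rw [← add_mul]

end Fractional

/-! ### The Lipschitz and Morrey norms in terms of closed balls -/

section Norms

variable {n : ℕ} {w : (Fin n → ℝ) → ℝ}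

lemma lipSeminorm_one_le_iff (hw : IsWeight w) {β : ℝ} {b : (Fin n → ℝ) → ℝ} {L : ℝ≥0∞} :
    lipSeminorm 1 β w b ≤ L ↔ ∀ (c : Fin n → ℝ) (r : ℝ), 0 < r →
      ∫⁻ x in closedBall c r, ‖b x - ⨍ y in closedBall c r, b y‖ₑ ≤
        L * (wMeasure w (closedBall c r) * wMeasure w (closedBall c r) ^ (β / n)) := by
  have key : ∀ (c : Fin n → ℝ) (r : ℝ), 0 < r → ((wmeas w (closedBall c r) ^ (β / (n : ℝ)))⁻¹ *
      ((wmeas w (closedBall c r))⁻¹ * ∫⁻ x in closedBall c r,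
        ‖b x - ⨍ y in closedBall c r, b y‖ₑ ^ (1 : ℝ) *
          ENNReal.ofReal (w x ^ ((1 : ℝ) - 1))) ^ ((1 : ℝ) / 1) ≤ L ↔
      ∫⁻ x in closedBall c r, ‖b x - ⨍ y in closedBall c r, b y‖ₑ ≤
        L * (wMeasure w (closedBall c r) * wMeasure w (closedBall c r) ^ (β / n))) := by
    intro c r hr
    have h0 := hw.wMeasure_cube_ne_zero c hr
    have ht := hw.wMeasure_cube_ne_top c r
    have h0' : wMeasure w (closedBall c r) ^ (β / n) ≠ 0 := by
      simp [ENNReal.rpow_eq_zero_iff, h0, ht]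
    have ht' : wMeasure w (closedBall c r) ^ (β / n) ≠ ∞ := by
      simp [ENNReal.rpow_eq_top_iff, h0, ht]
    simp only [wmeas_eq, sub_self, Real.rpow_zero, ENNReal.ofReal_one, mul_one, div_one,
      ENNReal.rpow_one]
    rw [ENNReal.inv_mul_le_iff h0' ht', ENNReal.inv_mul_le_iff h0 ht]
    refine iff_of_eq (congrArg _ ?_)
    ring
  simp only [lipSeminorm, iSup_le_iff]
  constructor
  · intro h c r hr
    exact (key c r hr).1 (h _ (isCube_closedBall c hr))
  · rintro h Q hQ
    obtain ⟨c, r, hr, rfl⟩ := isCube_iff.1 hQ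
    exact (key c r hr).2 (h c r hr)

lemma morreyNorm_le_iff (hw : IsWeight w) {E : Type*} [ENorm E] {p κ : ℝ} (hp : 0 < p)
    {u : (Fin n → ℝ) → ℝ} {F : (Fin n → ℝ) → E} {N : ℝ≥0∞} :
    morreyNorm p κ u w F ≤ N ↔ ∀ (c : Fin n → ℝ) (r : ℝ), 0 < r →
      ∫⁻ x in closedBall c r, ‖F x‖ₑ ^ p * ENNReal.ofReal (u x) ≤
        wMeasure w (closedBall c r) ^ κ * N ^ p := by
  have key : ∀ (c : Fin n → ℝ) (r : ℝ), 0 < r → (((wmeas w (closedBall c r) ^ κ)⁻¹ *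
      ∫⁻ x in closedBall c r, ‖F x‖ₑ ^ p * ENNReal.ofReal (u x)) ^ (1 / p) ≤ N ↔
      ∫⁻ x in closedBall c r, ‖F x‖ₑ ^ p * ENNReal.ofReal (u x) ≤
        wMeasure w (closedBall c r) ^ κ * N ^ p) := by
    intro c r hr
    have h0 := hw.wMeasure_cube_ne_zero c hr
    have ht := hw.wMeasure_cube_ne_top c r
    rw [wmeas_eq, one_div, ENNReal.rpow_inv_le_iff hp, ENNReal.inv_mul_le_iff]
    · simp [ENNReal.rpow_eq_zero_iff, h0, ht]
    · simp [ENNReal.rpow_eq_top_iff, h0, ht]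
  simp only [morreyNorm, iSup_le_iff]
  constructor
  · intro h c r hr
    exact (key c r hr).1 (h _ (isCube_closedBall c hr))
  · rintro h Q hQ
    obtain ⟨c, r, hr, rfl⟩ := isCube_iff.1 hQ
    exact (key c r hr).2 (h c r hr)

/-- A function of finite Morrey norm satisfies the local integrability condition in the definition
of the Morrey space. -/
lemma setLIntegral_lt_top_of_morreyNorm (hw : IsWeight w) {E : Type*} [ENorm E] {p κ : ℝ}
    (hp : 0 < p) {u : (Fin n → ℝ) → ℝ} {F : (Fin n → ℝ) → E} (hF : morreyNorm p κ u w F < ∞)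
    {K : Set (Fin n → ℝ)} (hK : IsCompact K) :
    ∫⁻ x in K, ‖F x‖ₑ ^ p * ENNReal.ofReal (u x) < ∞ := by
  obtain ⟨r, hr, hKr⟩ := hK.isBounded.subset_closedBall_lt 0 0
  refine (lintegral_mono_set hKr).trans_lt
    (((morreyNorm_le_iff (κ := κ) hw hp).1 le_rfl 0 r hr).trans_lt (ENNReal.mul_lt_top ?_ ?_))
  · simp [lt_top_iff_ne_top, ENNReal.rpow_eq_top_iff, hw.wMeasure_cube_ne_zero 0 hr,
      hw.wMeasure_cube_ne_top 0 r]
  · exact ENNReal.rpow_lt_top_of_nonneg hp.le hF.ne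

lemma ofReal_rpow_mul_ofReal_rpow_one_sub {x : ℝ} (hx : 0 < x) (q : ℝ) :
    ENNReal.ofReal x ^ q * ENNReal.ofReal (x ^ (1 - q)) = ENNReal.ofReal x := by
  rw [ENNReal.ofReal_rpow_of_pos hx, ← ENNReal.ofReal_mul (by positivity), ← Real.rpow_add hx,
    add_sub_cancel, Real.rpow_one]

/-- The Morrey norm of the indicator function of a cube. -/
lemma morreyNorm_indicator_le (hw : IsWeight w) {p κ : ℝ} (hp : 0 < p) (hκ0 : 0 ≤ κ)
    (hκ1 : κ ≤ 1) (c : Fin n → ℝ) (r : ℝ) :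
    morreyNorm p κ w w ((closedBall c r).indicator fun _ => (1 : ℝ)) ≤
      wMeasure w (closedBall c r) ^ ((1 - κ) / p) := by
  refine (morreyNorm_le_iff hw hp).2 fun c' r' hr' => ?_
  have hB : MeasurableSet (closedBall c r) := isClosed_closedBall.measurableSet
  have hB' : MeasurableSet (closedBall c' r') := isClosed_closedBall.measurableSet
  rw [← hw.lintegral_wMeasure _ hB', ← ENNReal.rpow_mul, div_mul_cancel₀ _ hp.ne']
  have e : ∀ x, ‖(closedBall c r).indicator (fun _ => (1 : ℝ)) x‖ₑ ^ p =
      (closedBall c r).indicator (fun _ => (1 : ℝ≥0∞)) x := by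
    intro x
    by_cases hx : x ∈ closedBall c r
    · rw [indicator_of_mem hx, indicator_of_mem hx]; simp
    · rw [indicator_of_notMem hx, indicator_of_notMem hx]; simp [hp]
  simp only [e]
  rw [lintegral_indicator_const hB, one_mul, Measure.restrict_apply hB]
  set I := wMeasure w (closedBall c r ∩ closedBall c' r')
  calc I = I ^ κ * I ^ (1 - κ) := by
        rw [← ENNReal.rpow_add_of_nonneg _ _ hκ0 (by linarith), add_sub_cancel, ENNReal.rpow_one]
    _ ≤ _ := by
        have h1 : 0 ≤ 1 - κ := by linarith
        gcongr
        · exact measure_mono inter_subset_right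
        · exact measure_mono inter_subset_left

end Norms

/-! ### The two implications -/

section Equivalence

variable {n : ℕ} {w b : (Fin n → ℝ) → ℝ} {p q β κ : ℝ}

/-- The fractional maximal function absorbs the factor `w ^ (1 - q)`, because the pointwise bound for
the maximal commutator carries a factor `w`. -/
theorem isMorreyBounded_of_memLip (hn : n ≠ 0) (hw : MemA1 w) (hβ : 0 < β) (hp : 1 < p)
    (hpq : p < q) (hq : 1 / q = 1 / p - β / n) (hκ0 : 0 < κ) (hκ1 : κ < p / q)
    (h : MemLip β w b) :
    IsMorreyBounded (maximalCommutator b) p κ w w q (κ * q / p) (fun x => w x ^ (1 - q)) w := by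
  have hp0 : 0 < p := by linarith
  have hq0 : 0 < q := by linarith
  have hs : 0 < β / n := div_pos hβ (by positivity)
  obtain ⟨hb, hL⟩ := h
  obtain ⟨C, hC1, hC⟩ := hw.exists_isA1Bound
  have hw := hw.1
  lift lipSeminorm 1 β w b to ℝ≥0 using hL.ne with L hL'
  obtain ⟨K, hK⟩ := exists_ae_enorm_sub_average_le hn hw hC1 hC hs hb
    ((lipSeminorm_one_le_iff hw).1 hL'.ge)
  obtain ⟨K₁, hK₁⟩ := exists_setLIntegral_fracMaximal_le hw hC1 hC hp hpq hq hκ0 hκ1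
  set K₂ : ℝ≥0 := 2 * K * C * K₁ ^ (1 / q)
  refine ⟨K₂, fun f hf => ?_⟩
  obtain ⟨hfm, -, hfN⟩ := hf
  have hfm' : AEMeasurable f := hfm.aemeasurable
  set N := morreyNorm p κ w w f
  have hN : ∀ (c : Fin n → ℝ) (r : ℝ), 0 < r →
      ∫⁻ y in closedBall c r, ‖f y‖ₑ ^ p ∂(wMeasure w) ≤
        wMeasure w (closedBall c r) ^ κ * N ^ p := by
    intro c r hr
    rw [hw.lintegral_wMeasure _ isClosed_closedBall.measurableSet]
    exact (morreyNorm_le_iff hw hp0).1 le_rfl c r hr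
  have hbound : morreyNorm q (κ * q / p) (fun x => w x ^ (1 - q)) w (maximalCommutator b f) ≤
      K₂ * N := by
    refine (morreyNorm_le_iff hw hq0).2 fun c r hr => ?_
    calc ∫⁻ x in closedBall c r, ‖maximalCommutator b f x‖ₑ ^ q * ENNReal.ofReal (w x ^ (1 - q))
        ≤ ∫⁻ x in closedBall c r, (2 * K * C : ℝ≥0∞) ^ q *
            (fracMaximal w (β / n) f x ^ q * ENNReal.ofReal (w x)) := by
          refine lintegral_mono_ae (ae_restrict_of_ae ?_)
          filter_upwards [ae_maximalCommutator_le hw hC hK hfm', hw.ae_pos] with x hx hwx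
          rw [enorm_eq_self]
          calc _ ≤ (2 * K * C * ENNReal.ofReal (w x) * fracMaximal w (β / n) f x) ^ q *
                ENNReal.ofReal (w x ^ (1 - q)) := by gcongr
            _ = (2 * K * C : ℝ≥0∞) ^ q * (fracMaximal w (β / n) f x ^ q *
                  (ENNReal.ofReal (w x) ^ q * ENNReal.ofReal (w x ^ (1 - q)))) := by
                rw [ENNReal.mul_rpow_of_nonneg _ _ hq0.le, ENNReal.mul_rpow_of_nonneg _ _ hq0.le]
                ring
            _ = _ := by rw [ofReal_rpow_mul_ofReal_rpow_one_sub hwx]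
      _ = (2 * K * C : ℝ≥0∞) ^ q *
            ∫⁻ x in closedBall c r, fracMaximal w (β / n) f x ^ q ∂(wMeasure w) := by
          rw [lintegral_const_mul' _ _ (by finiteness),
            hw.lintegral_wMeasure _ isClosed_closedBall.measurableSet]
      _ ≤ (2 * K * C : ℝ≥0∞) ^ q *
            (K₁ * (wMeasure w (closedBall c r) ^ (κ * q / p) * N ^ q)) := by
          gcongr
          exact hK₁ f N hfm' hN c r hr
      _ = _ := by
          have e : (K₂ : ℝ≥0∞) = 2 * K * C * (K₁ : ℝ≥0∞) ^ (1 / q) := by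
            simp only [K₂]
            push_cast
            rw [ENNReal.coe_rpow_of_nonneg _ (by positivity)]
          have e' : (2 * K * C * (K₁ : ℝ≥0∞) ^ (1 / q) * N) ^ q =
              (2 * K * C : ℝ≥0∞) ^ q * K₁ * N ^ q := by
            rw [ENNReal.mul_rpow_of_nonneg _ N hq0.le, ENNReal.mul_rpow_of_nonneg _ _ hq0.le,
              ← ENNReal.rpow_mul, one_div_mul_cancel hq0.ne', ENNReal.rpow_one]
          rw [e, e']
          ring
  have hfin : morreyNorm q (κ * q / p) (fun x => w x ^ (1 - q)) w (maximalCommutator b f) < ∞ :=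
    hbound.trans_lt (ENNReal.mul_lt_top ENNReal.coe_lt_top hfN)
  exact ⟨⟨(aemeasurable_maximalCommutator hb.aestronglyMeasurable.aemeasurable
    hfm').aestronglyMeasurable, fun K hK => setLIntegral_lt_top_of_morreyNorm hw hq0 hfin hK, hfin⟩,
    hbound⟩

/-- Testing the maximal commutator on the indicator function of a cube `B`: on `B` it dominates
the oscillation `|b - b_B|`. -/
theorem memLip_of_isMorreyBounded (hw : IsWeight w) (hb : LocallyIntegrable b) (hp : 1 < p)
    (hpq : p < q) (hq : 1 / q = 1 / p - β / n) (hκ0 : 0 < κ) (hκ1 : κ < p / q)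
    (h : IsMorreyBounded (maximalCommutator b) p κ w w q (κ * q / p) (fun x => w x ^ (1 - q)) w) :
    MemLip β w b := by
  have hp0 : 0 < p := by linarith
  have hq0 : 0 < q := by linarith
  have hκ1' : κ ≤ 1 := hκ1.le.trans ((div_le_one hq0).2 hpq.le)
  obtain ⟨L, hL⟩ := h
  refine ⟨hb, lt_of_le_of_lt ?_ (ENNReal.coe_lt_top (r := L))⟩
  refine (lipSeminorm_one_le_iff hw).2 fun c r hr => ?_
  set B := closedBall c r
  have hBm : MeasurableSet B := isClosed_closedBall.measurableSet
  set V := wMeasure w B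
  have hV0 : V ≠ 0 := hw.wMeasure_cube_ne_zero c hr
  have hVt : V ≠ ∞ := hw.wMeasure_cube_ne_top c r
  set f : (Fin n → ℝ) → ℝ := B.indicator fun _ => 1
  have hfV : morreyNorm p κ w w f ≤ V ^ ((1 - κ) / p) :=
    morreyNorm_indicator_le hw hp0 hκ0.le hκ1' c r
  have hfN : morreyNorm p κ w w f < ∞ := by
    refine hfV.trans_lt ?_
    simp [lt_top_iff_ne_top, ENNReal.rpow_eq_top_iff, hV0, hVt]
  have hf : MemMorrey p κ w w f :=
    ⟨(measurable_const.indicator hBm).aestronglyMeasurable,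
      fun K hK => setLIntegral_lt_top_of_morreyNorm hw hp0 hfN hK, hfN⟩
  have hMb := (morreyNorm_le_iff hw hq0).1 ((hL f hf).2.trans (mul_le_mul_right hfV _)) c r hr
  set m := ⨍ y in B, b y
  have hosc : ∀ x ∈ B, ‖b x - m‖ₑ ≤ maximalCommutator b f x := by
    intro x hx
    rw [← edist_eq_enorm_sub, edist_comm, edist_eq_enorm_sub]
    refine (enorm_setAverage_sub_le (volume_cube_ne_zero c hr) (volume_cube_ne_top c hr)
      (hb.integrableOn_isCompact (isCompact_closedBall c r)) (b x)).trans ?_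
    refine le_trans (le_of_eq ?_) (maximalCommutator_le_iff.1 le_rfl c r hr hx)
    congr 1
    refine setLIntegral_congr_fun hBm fun y hy => ?_
    simp only [f]
    rw [indicator_of_mem hy, enorm_one, mul_one, ← edist_eq_enorm_sub, edist_comm,
      edist_eq_enorm_sub]
  have hbm : AEMeasurable b (wMeasure w) :=
    hb.aestronglyMeasurable.aemeasurable.mono_ac (wMeasure_absolutelyContinuous w)
  have hwm : AEMeasurable w (wMeasure w) :=
    hw.aemeasurable.mono_ac (wMeasure_absolutelyContinuous w)
  -- Hölder's inequality for `w dx`, applied to `|b - m| / w`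
  calc ∫⁻ x in B, ‖b x - m‖ₑ
      = ∫⁻ x in B, ‖b x - m‖ₑ * (ENNReal.ofReal (w x))⁻¹ ∂(wMeasure w) := by
        rw [hw.lintegral_wMeasure _ hBm]
        refine lintegral_congr_ae (ae_restrict_of_ae ?_)
        filter_upwards [hw.ae_pos] with x hx
        rw [mul_assoc, ENNReal.inv_mul_cancel (by simpa using hx) ENNReal.ofReal_ne_top, mul_one]
    _ ≤ (∫⁻ x in B, (‖b x - m‖ₑ * (ENNReal.ofReal (w x))⁻¹) ^ q ∂(wMeasure w)) ^ (1 / q) *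
          V ^ (1 - 1 / q) :=
        setLIntegral_le_rpow_mul_measure_rpow ((hbm.sub_const m).enorm.mul hwm.ennreal_ofReal.inv)
          B (hp.trans hpq)
    _ ≤ (V ^ (κ * q / p) * (L * V ^ ((1 - κ) / p)) ^ q) ^ (1 / q) * V ^ (1 - 1 / q) := by
        gcongr ?_ ^ _ * _
        refine le_trans ?_ hMb
        rw [hw.lintegral_wMeasure _ hBm]
        refine setLIntegral_mono_ae' hBm ?_
        filter_upwards [hw.ae_pos] with x hx hxB
        have h0 : ENNReal.ofReal (w x) ≠ 0 := by simpa using hx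
        calc (‖b x - m‖ₑ * (ENNReal.ofReal (w x))⁻¹) ^ q * ENNReal.ofReal (w x)
            = (‖b x - m‖ₑ * (ENNReal.ofReal (w x))⁻¹) ^ q *
                (ENNReal.ofReal (w x) ^ q * ENNReal.ofReal (w x ^ (1 - q))) := by
              rw [ofReal_rpow_mul_ofReal_rpow_one_sub hx]
          _ = ‖b x - m‖ₑ ^ q * ENNReal.ofReal (w x ^ (1 - q)) := by
              rw [← mul_assoc, ← ENNReal.mul_rpow_of_nonneg _ _ hq0.le, mul_assoc,
                ENNReal.inv_mul_cancel h0 ENNReal.ofReal_ne_top, mul_one]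
          _ ≤ _ := by
              rw [enorm_eq_self]
              gcongr
              exact hosc x hxB
    _ = L * (V ^ (κ / p) * V ^ ((1 - κ) / p) * V ^ (1 - 1 / q)) := by
        rw [ENNReal.mul_rpow_of_nonneg _ _ (by positivity), ← ENNReal.rpow_mul, ← ENNReal.rpow_mul,
          mul_one_div_cancel hq0.ne', ENNReal.rpow_one]
        have : κ * q / p * (1 / q) = κ / p := by field_simp
        rw [this]
        ring
    _ = L * (V * V ^ (β / n)) := by
        congr 1
        nth_rewrite 4 [← ENNReal.rpow_one V]
        rw [← ENNReal.rpow_add _ _ hV0 hVt, ← ENNReal.rpow_add _ _ hV0 hVt,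
          ← ENNReal.rpow_add _ _ hV0 hVt]
        congr 1
        rw [hq]
        ring

end Equivalence

end WeightedMorrey

theorem theorem1p1 (n : ℕ) (b w : (Fin n → ℝ) → ℝ) (p q β κ : ℝ)
    (hb : MeasureTheory.LocallyIntegrable b MeasureTheory.volume)
    (hw : WeightedMorrey.MemA1 w)
    (hβ0 : 0 < β) (hβ1 : β < 1)
    (hp1 : 1 < p) (hpn : p < (n : ℝ) / β)
    (hq : 1 / q = 1 / p - β / (n : ℝ))
    (hκ0 : 0 < κ) (hκ1 : κ < p / q) :
    WeightedMorrey.MemLip β w b ↔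
      WeightedMorrey.IsMorreyBounded (WeightedMorrey.maximalCommutator b)
        p κ w w q (κ * q / p) (fun x => w x ^ (1 - q)) w := by
  have hp0 : 0 < p := by linarith
  have hn0 : (0 : ℝ) < n := by
    have : 0 < (n : ℝ) / β := hp0.trans hpn
    exact (div_pos_iff_of_pos_right hβ0).1 this
  have hn : n ≠ 0 := by
    rintro rfl
    simp at hn0
  have hs : 0 < β / (n : ℝ) := div_pos hβ0 hn0
  have hsp : β / (n : ℝ) < 1 / p := by
    rw [lt_div_iff₀ hβ0] at hpn
    rw [div_lt_div_iff₀ hn0 hp0]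
    linarith
  have hq0 : 0 < q := one_div_pos.1 (by linarith)
  have hpq : p < q := (one_div_lt_one_div hq0 hp0).1 (by linarith)
  exact ⟨WeightedMorrey.isMorreyBounded_of_memLip hn hw hβ0 hp1 hpq hq hκ0 hκ1,
    WeightedMorrey.memLip_of_isMorreyBounded hw.1 hb hp1 hpq hq hκ0 hκ1⟩
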